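/- For a sequence $\sigma=\langle\sigma(1),\dots,\sigma(n)\rangle$ of integers (possibly with repetitions) let $\mathsf{lis}(\sigma)$ be the maximum $\ell$ such that $\sigma(i_1)<\dots<\sigma(i_\ell)$ for some indices $1\le i_1<\dots<i_\ell\le n$. The model of computation is a random access machine with a read-only input ($n$, $s$ and the entries of $\sigma$), a write-only output, and a readable and writable working memory, whose size is measured in bits. The working memory consists of words of $O(\log n)$ bits each (operated on by addition, truncated subtraction, halving, comparison and indirect addressing), of entry cells, and of the head position. An entry cell holds an entry of the input, represented by its position, i.e. by $O(\log n)$ bits whatever the size of the integer is; the contents of two entry cells can be compared as integers in one step. The entries are read from left to right by a head that can be sent back to the first entry; each scan is called a pass, and entries get into entry cells only from under the head. Every instruction takes one unit of time. **Theorem.** There is one algorithm (program) for this machine that, given an integer $s$ with $\sqrt n\le s\le n$ and an integer sequence $\sigma$ of length $n$, always stops with output $\mathsf{lis}(\sigma)$, and that for $n\ge 2$ runs in $$O\!\left(\frac{n^2\log n}{s}\right)$$ time, uses $O(s\log n)$ bits of working memory, and makes $O(n/s)$ left-to-right passes over the input. The constants in the $O$-notation do not depend on $n$, $s$ and $\sigma$,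 and the amount of working memory depends only on $n$ and $s$. -/

import Mathlib

namespace SpaceLIS

open Classical in
/-- `lis σ`: the length of a longest (strictly) increasing subsequence of the integer sequence `σ`.
A subsequence is given by its set of positions. -/
noncomputable def lis {n : ℕ} (σ : Fin n → ℤ) : ℕ :=
  (Finset.univ.filter fun I : Finset (Fin n) => StrictMonoOn σ (I : Set (Fin n))).sup Finset.card

/-!
### The machine model

A random access machine with a read-only input, a write-only output and a readable and writable
working memory of limited size.

* Read-only input: the length `n`, the parameter `s` and the entries of the sequence. The entries
  are read by a head that scans the sequence from left to right and can be sent back to the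
  first entry; each such scan is a pass.
* Working memory: `cells` word cells, each holding a natural number of at most `wordBits` bits,
  and `cells` entry cells. An entry cell is empty or holds an entry of the input, represented by its
  position; it gets its content from the entry under the head or from another entry cell. Since
  only the position is stored, the size of the input integers does not matter: comparing the
  contents of two entry cells looks up the two integers in the read-only input.
* An access to a cell that does not exist, to an empty entry cell or to an entry beyond the end of
  the input, and a number that does not fit into a word, make the machine fail.
* The program is a fixed finite list of instructions; each executed instruction takes one step.
-/

/-- Instructions. `W` denotes the word cells and `E` the entry cells; numbers `d a b` are fixed
addresses of word cells, and `l` is a position in the program. -/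
inductive Instr where
  /-- `W[d] := c` -/
  | const (d c : ℕ)
  /-- `W[d] := n` -/
  | len (d : ℕ)
  /-- `W[d] := s` -/
  | par (d : ℕ)
  /-- `W[d] := W[a] + W[b]` -/
  | add (d a b : ℕ)
  /-- `W[d] := max (W[a] - W[b]) 0` -/
  | sub (d a b : ℕ)
  /-- `W[d] := ⌊W[a] / 2⌋` -/
  | half (d a : ℕ)
  /-- `W[d] := W[W[a]]` -/
  | load (d a : ℕ)
  /-- `W[W[d]] := W[a]` -/
  | store (d a : ℕ)
  /-- go to `l` -/
  | jump (l : ℕ)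
  /-- if `W[a] < W[b]` go to `l` -/
  | jlt (a b l : ℕ)
  /-- move the head to the next entry -/
  | advance
  /-- move the head to the first entry; this starts a new pass -/
  | rewind
  /-- `E[W[d]] :=` the entry under the head -/
  | take (d : ℕ)
  /-- `E[W[d]] := E[W[a]]` -/
  | copy (d a : ℕ)
  /-- if the integer `E[W[a]]` is smaller than the integer `E[W[b]]` go to `l` -/
  | cmp (a b l : ℕ)
  /-- append `W[a]` to the output -/
  | out (a : ℕ)
  /-- stop -/
  | halt

/-- A program is a finite list of instructions. -/
abbrev Program : Type := List Instr

/-- The input and the size of the working memory. -/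
structure Env (n : ℕ) where
  /-- the input sequence -/
  entry : Fin n → ℤ
  /-- the input parameter `s` -/
  param : ℕ
  /-- the number of bits of a word cell -/
  wordBits : ℕ
  /-- the number of word cells, and the number of entry cells -/
  cells : ℕ

/-- The size of the working memory in bits: the word cells, the entry cells, and the head position.
An entry cell (empty or a position `0, …, n - 1`) and the head position (`0, …, n`) have `n + 1`
possible values each, which fit into `⌊log₂ n⌋ + 1` bits. -/
def Env.memoryBits {n : ℕ} (M : Env n) : ℕ :=
  M.cells * M.wordBits + M.cells * (Nat.log 2 n + 1) + (Nat.log 2 n + 1)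

/-- Configurations of the machine. Only the cells with an address below `cells` can be accessed. -/
structure Config (n : ℕ) where
  /-- program counter -/
  pc : ℕ
  /-- word cells -/
  words : ℕ → ℕ
  /-- entry cells -/
  entries : ℕ → Option (Fin n)
  /-- head position; `n` means that the end of the input has been passed -/
  head : ℕ
  /-- number of passes started so far -/
  passes : ℕ
  /-- output written so far -/
  output : List ℕ

/-- The initial configuration. -/
def Config.init (n : ℕ) : Config n where
  pc := 0
  words := fun _ => 0
  entries := fun _ => none
  head := 0
  passes := 1
  output := []

section
variable {n : ℕ} (M : Env n) (c : Config n)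

/-- Read the word cell `a`. -/
def getWord (a : ℕ) : Option ℕ :=
  if a < M.cells then some (c.words a) else none

/-- Read the entry cell `a`. -/
def getEntry (a : ℕ) : Option (Fin n) :=
  if a < M.cells then c.entries a else none

/-- Continue at position `l` of the program. -/
def goto (l : ℕ) : Config n :=
  { c with pc := l }

/-- Write `v` into the word cell `a` and continue with the next instruction. -/
def setWord (a v : ℕ) : Option (Config n) :=
  if a < M.cells ∧ v < 2 ^ M.wordBits then
    some { c with pc := c.pc + 1, words := Function.update c.words a v }
  else none

/-- Write the entry `i` into the entry cell `a` and continue with the next instruction. -/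
def setEntry (a : ℕ) (i : Fin n) : Option (Config n) :=
  if a < M.cells then
    some { c with pc := c.pc + 1, entries := Function.update c.entries a (some i) }
  else none

/-- The entry under the head. -/
def current : Option (Fin n) :=
  if h : c.head < n then some ⟨c.head, h⟩ else none

/-- The effect of one instruction; `none` if the machine stops or fails. -/
def exec : Instr → Option (Config n)
  | .const d v => setWord M c d v
  | .len d => setWord M c d n
  | .par d => setWord M c d M.param
  | .add d a b => do
      let x ← getWord M c a
      let y ← getWord M c b
      setWord M c d (x + y)
  | .sub d a b => do
      let x ← getWord M c a
      let y ← getWord M c b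
      setWord M c d (x - y)
  | .half d a => do
      let x ← getWord M c a
      setWord M c d (x / 2)
  | .load d a => do
      let p ← getWord M c a
      let x ← getWord M c p
      setWord M c d x
  | .store d a => do
      let p ← getWord M c d
      let x ← getWord M c a
      setWord M c p x
  | .jump l => some (goto c l)
  | .jlt a b l => do
      let x ← getWord M c a
      let y ← getWord M c b
      some (goto c (if x < y then l else c.pc + 1))
  | .advance =>
      if c.head < n then some { c with pc := c.pc + 1, head := c.head + 1 } else none
  | .rewind => some { c with pc := c.pc + 1, head := 0, passes := c.passes + 1 }
  | .take d => do
      let p ← getWord M c d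
      let i ← current c
      setEntry M c p i
  | .copy d a => do
      let p ← getWord M c d
      let q ← getWord M c a
      let i ← getEntry M c q
      setEntry M c p i
  | .cmp a b l => do
      let p ← getWord M c a
      let q ← getWord M c b
      let i ← getEntry M c p
      let j ← getEntry M c q
      some (goto c (if M.entry i < M.entry j then l else c.pc + 1))
  | .out a => do
      let x ← getWord M c a
      some { c with pc := c.pc + 1, output := c.output ++ [x] }
  | .halt => none

end

/-- One step of the program `P`. -/
def step {n : ℕ} (P : Program) (M : Env n) (c : Config n) : Option (Config n) :=
  P[c.pc]?.bind (exec M c)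

/-- The configuration after exactly `t` steps, if the machine has not stopped or failed before. -/
def run {n : ℕ} (P : Program) (M : Env n) : ℕ → Config n → Option (Config n)
  | 0, c => some c
  | t + 1, c => (step P M c).bind (run P M t)

/-- Started on the input and with the working memory described by `M`, the program `P` regularly
stops (at an instruction `halt`) after `t` steps and `p` passes, and its whole output is the
number `v`. -/
def Computes {n : ℕ} (P : Program) (M : Env n) (v t p : ℕ) : Prop :=
  ∃ c : Config n, run P M t (Config.init n) = some c ∧ P[c.pc]? = some Instr.halt ∧
    c.output = [v] ∧ c.passes = p

end SpaceLIS

namespace SpaceLIS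

/-! The largest rank is `lis` (`lis_eq`). Positions of equal rank form a pile, as in patience
sorting. Values along a pile never increase (`le_of_rank_eq`), so the latest position, its top,
carries the smallest value, and the tops of successive piles increase (`Piles.strictMono`). Binary
search among the tops therefore locates the pile of the next entry (`Piles.rank_eq`).

Keeping all tops could take n cells. The program keeps a window of 2s + 2 consecutive piles starting
at pile `low`. An entry larger than all tops of a full window lies above the window and is ignored.
An entry not larger than the lowest top has rank at most `low`, and the search cannot tell whether
equality holds. This is settled by a stored increasing list of the positions of rank `low`, closed
by the sentinel n: the current size of the lowest pile is the index of the next list element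
(`list_eq_iff`). In the first window `low` is 0 and no list is needed, since ranks are positive.

A round begins with a counting pass. If it leaves a pile of the window empty, the answer is known
(`Piles.lis_eq`). Otherwise, since n ≤ s², one of the piles with index s, …, 2s - 1 has at most s
positions (`exists_pileCount_le`); a second pass records them, and this pile becomes the lowest of
the next window. The window thus moves up by at least s while ranks stay at most n, which leaves
O(n/s) rounds of two passes with O(log n) steps per entry. The words needed are three arrays of
length 2s + 2 and the registers. -/

/-- The length of a longest strictly increasing subsequence of `a` that ends at position `j`. -/
def rank (a : ℕ → ℤ) (j : ℕ) : ℕ :=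
  (Finset.univ : Finset (Fin j)).sup (fun i => if a i < a j then rank a i else 0) + 1
termination_by j
decreasing_by exact i.2

/-- The number of positions before `j` of rank `k`. -/
def pileCount (a : ℕ → ℤ) (k j : ℕ) : ℕ := Nat.count (fun p => rank a p = k) j

/-! ### Ranks and piles of a sequence -/

section rank
variable {a : ℕ → ℤ}

theorem rank_pos (j : ℕ) : 0 < rank a j := by
  rw [rank]; omega

theorem rank_lt_rank {i j : ℕ} (hij : i < j) (h : a i < a j) : rank a i < rank a j := by
  rw [rank.eq_1 a j, Nat.lt_succ_iff]
  have := Finset.le_sup (f := fun i : Fin j => if a i < a j then rank a i else 0)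
    (Finset.mem_univ ⟨i, hij⟩)
  simpa [h] using this

theorem exists_rank_eq_pred {j k : ℕ} (h : rank a j = k + 1) (hk : 0 < k) :
    ∃ i < j, a i < a j ∧ rank a i = k := by
  rw [rank, Nat.add_right_cancel_iff] at h
  have hne : (Finset.univ : Finset (Fin j)).Nonempty := by
    by_contra hne
    rw [Finset.not_nonempty_iff_eq_empty] at hne
    rw [hne] at h
    simp at h
    omega
  obtain ⟨i, -, hi⟩ := Finset.exists_mem_eq_sup _ hne
    (fun i : Fin j => if a i < a j then rank a i else 0)
  rw [h] at hi
  split_ifs at hi with hlt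
  · exact ⟨i, i.2, hlt, hi.symm⟩
  · omega

/-- A chain of predecessors lowers the rank by exactly one at each step, so it meets every smaller
positive rank, at smaller values and earlier positions. -/
theorem exists_rank_eq {j k : ℕ} (hk : 0 < k) (h : k < rank a j) :
    ∃ i < j, a i < a j ∧ rank a i = k := by
  induction j using Nat.strong_induction_on with
  | _ j ih =>
    obtain ⟨i, hij, hlt, hi⟩ := exists_rank_eq_pred (a := a) (j := j) (k := rank a j - 1)
      (by omega) (by omega)
    rcases eq_or_lt_of_le (show k ≤ rank a i by omega) with he | hl
    · exact ⟨i, hij, hlt, he.symm⟩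
    · obtain ⟨i', h1, h2, h3⟩ := ih i hij hl
      exact ⟨i', h1.trans hij, h2.trans hlt, h3⟩

theorem rank_le (j : ℕ) : rank a j ≤ j + 1 := by
  induction j using Nat.strong_induction_on with
  | _ j ih =>
    by_contra hlt
    obtain ⟨i, hij, -, hi⟩ := exists_rank_eq (a := a) (j := j) (k := j + 1) (by omega) (by omega)
    have := ih i hij
    omega

/-- A larger value at the later position would extend a subsequence ending at the earlier one and
raise the rank. -/
theorem le_of_rank_eq {i j : ℕ} (hij : i ≤ j) (h : rank a i = rank a j) : a j ≤ a i := by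
  rcases hij.eq_or_lt with rfl | hlt
  · exact le_rfl
  · by_contra hc
    have := rank_lt_rank hlt (not_le.1 hc)
    omega

theorem pileCount_zero (k : ℕ) : pileCount a k 0 = 0 := Nat.count_zero _

theorem pileCount_succ (k j : ℕ) :
    pileCount a k (j + 1) = pileCount a k j + if rank a j = k then 1 else 0 :=
  Nat.count_succ _ _

theorem pileCount_mono (k : ℕ) {i j : ℕ} (h : i ≤ j) : pileCount a k i ≤ pileCount a k j :=
  Nat.count_monotone _ h

theorem pileCount_lt {k i j : ℕ} (h : i < j) (hi : rank a i = k) :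
    pileCount a k i < pileCount a k j := by
  have := pileCount_mono (a := a) k (Nat.succ_le_of_lt h)
  rw [Nat.succ_eq_add_one, pileCount_succ, if_pos hi] at this
  omega

theorem pileCount_eq_of_forall_ne {k i j : ℕ} (hij : i ≤ j)
    (h : ∀ p, i ≤ p → p < j → rank a p ≠ k) : pileCount a k j = pileCount a k i := by
  induction j, hij using Nat.le_induction with
  | base => rfl
  | succ j hj ih =>
    rw [pileCount_succ, if_neg (h j hj (by omega)), ih fun p h1 h2 => h p h1 (by omega),
      Nat.add_zero]

/-- If the positions of rank `k` below `n` are listed in `f`, followed by `n`, then `f` tells which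
positions have rank `k`. -/
theorem list_eq_iff {n k : ℕ} {f : ℕ → ℕ} (hf : ∀ p < n, rank a p = k → f (pileCount a k p) = p)
    (hn : f (pileCount a k n) = n) {j : ℕ} (hj : j < n) :
    f (pileCount a k j) ≤ n ∧ (f (pileCount a k j) = j ↔ rank a j = k) := by
  by_cases hex : ∃ p, j ≤ p ∧ p < n ∧ rank a p = k
  · classical
    obtain ⟨h1, h2, h3⟩ := Nat.find_spec hex
    have hmin := fun p => Nat.find_min (H := hex) (m := p)
    set p := Nat.find hex
    -- No position of rank k lies between j and the next one p, so the index computed at j already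
    -- points to p.
    have he : pileCount a k p = pileCount a k j :=
      pileCount_eq_of_forall_ne h1 fun q hq1 hq2 hq3 => hmin q hq2 ⟨hq1, by omega, hq3⟩
    have hp := hf p h2 h3
    rw [he] at hp
    refine ⟨by omega, fun h => ?_, hf j hj⟩
    rw [← hp, h] at h3
    exact h3
  · push Not at hex
    -- The pile gets no further position, so the index points to the sentinel, which differs from
    -- every j < n.
    have he : pileCount a k n = pileCount a k j := pileCount_eq_of_forall_ne hj.le hex
    rw [he] at hn
    exact ⟨hn.le, fun h => by omega, hf j hj⟩

/-- Pigeonhole: piles are disjoint, so s piles of at least s + 1 positions would need s(s + 1) > n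
positions. The lower end s of the range makes the window advance; the upper end keeps the pile
inside the window. -/
theorem exists_pileCount_le {n s : ℕ} (hs : 0 < s) (hn : n ≤ s * s) (b : ℕ) :
    ∃ k, s ≤ k ∧ k < 2 * s ∧ pileCount a (b + k) n ≤ s := by
  by_contra! hc
  have hsum : ∑ k ∈ Finset.Ico s (2 * s), pileCount a (b + k) n ≤ n := by
    have : ∀ m, ∑ k ∈ Finset.Ico s (2 * s), pileCount a (b + k) m ≤ m := by
      intro m
      induction m with
      | zero => simp [pileCount_zero]
      | succ m ih =>
        simp only [pileCount_succ, Finset.sum_add_distrib]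
        have : ∑ k ∈ Finset.Ico s (2 * s), (if rank a m = b + k then 1 else 0) ≤ 1 := by
          rw [← Finset.card_filter, Finset.card_le_one]
          intro x hx y hy
          simp only [Finset.mem_filter] at hx hy
          omega
        omega
    exact this n
  have hle : ∑ _k ∈ Finset.Ico s (2 * s), (s + 1) ≤
      ∑ k ∈ Finset.Ico s (2 * s), pileCount a (b + k) n :=
    Finset.sum_le_sum fun k hk => by
      rw [Finset.mem_Ico] at hk
      exact hc k hk.1 hk.2
  rw [Finset.sum_const, Nat.card_Ico, smul_eq_mul, show 2 * s - s = s by omega] at hle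
  nlinarith

end rank

/-! ### The longest increasing subsequence in terms of ranks -/

section lis
variable {n : ℕ} {σ : Fin n → ℤ} {a : ℕ → ℤ}

/-- Induction along the subsequence: passing from an element to its predecessor in `I` loses one
element and lowers the rank by at least one. -/
theorem card_filter_le_rank (ha : ∀ p, σ p = a p) {I : Finset (Fin n)}
    (hI : StrictMonoOn σ (I : Set (Fin n))) (p : Fin n) (hp : p ∈ I) :
    (I.filter (· ≤ p)).card ≤ rank a p := by
  induction p using WellFoundedLT.induction with
  | _ p ih =>
    rcases (I.filter (· < p)).eq_empty_or_nonempty with he | hne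
    · have : I.filter (· ≤ p) ⊆ {p} := fun x hx => by
        rw [Finset.mem_filter] at hx
        rw [Finset.mem_singleton]
        by_contra hxp
        have : x ∈ I.filter (· < p) := Finset.mem_filter.2 ⟨hx.1, lt_of_le_of_ne hx.2 hxp⟩
        simp [he] at this
      have := Finset.card_le_card this
      have := rank_pos (a := a) p
      simp at *
      omega
    · obtain ⟨q, hq, hmax⟩ := (I.filter (· < p)).exists_max_image id hne
      rw [Finset.mem_filter] at hq
      have hsub : I.filter (· ≤ p) ⊆ insert p (I.filter (· ≤ q)) := fun x hx => by
        rw [Finset.mem_filter] at hx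
        rw [Finset.mem_insert, Finset.mem_filter]
        rcases hx.2.eq_or_lt with h | h
        · exact Or.inl h
        · exact Or.inr ⟨hx.1, hmax x (Finset.mem_filter.2 ⟨hx.1, h⟩)⟩
      have h1 := (Finset.card_le_card hsub).trans (Finset.card_insert_le _ _)
      have h2 := ih q hq.2 hq.1
      have h3 : σ q < σ p := hI hq.1 hp hq.2
      rw [ha, ha] at h3
      have := rank_lt_rank (Fin.lt_def.1 hq.2) h3
      omega

/-- The subsequence is built from a predecessor of rank one less; the clause that p is its last
element lets the induction append the next position. -/
theorem exists_strictMonoOn_card_eq_rank (ha : ∀ p, σ p = a p) (p : Fin n) :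
    ∃ I : Finset (Fin n), StrictMonoOn σ (I : Set (Fin n)) ∧ p ∈ I ∧ (∀ x ∈ I, x ≤ p) ∧
      I.card = rank a p := by
  induction p using WellFoundedLT.induction with
  | _ p ih =>
    by_cases h1 : rank a p = 1
    · exact ⟨{p}, by simp, by simp, by simp, by simp [h1]⟩
    · have := rank_pos (a := a) p
      obtain ⟨i, hi, hlt, hr⟩ := exists_rank_eq_pred (a := a) (j := p) (k := rank a p - 1)
        (by omega) (by omega)
      obtain ⟨I, hmono, hmem, hle, hcard⟩ := ih ⟨i, hi.trans p.2⟩ (Fin.lt_def.2 hi)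
      have hlt' : ∀ x ∈ I, x < p := fun x hx => (hle x hx).trans_lt (Fin.lt_def.2 hi)
      have hσ : ∀ x ∈ I, σ x < σ p := fun x hx => by
        refine (hmono.monotoneOn hx hmem (hle x hx)).trans_lt ?_
        rw [ha, ha]; exact hlt
      have hp : p ∉ I := fun h => lt_irrefl _ (hlt' p h)
      refine ⟨insert p I, ?_, Finset.mem_insert_self _ _, ?_, ?_⟩
      · intro x hx y hy hxy
        simp only [Finset.coe_insert, Set.mem_insert_iff, Finset.mem_coe] at hx hy
        rcases hx with rfl | hx
        · rcases hy with rfl | hy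
          · exact absurd hxy (lt_irrefl _)
          · exact absurd (hxy.trans (hlt' y hy)) (lt_irrefl _)
        · rcases hy with rfl | hy
          · exact hσ x hx
          · exact hmono hx hy hxy
      · intro x hx
        rcases Finset.mem_insert.1 hx with rfl | hx
        · exact le_rfl
        · exact (hlt' x hx).le
      · rw [Finset.card_insert_of_notMem hp, hcard]
        simp only at hr ⊢
        omega

theorem lis_eq (ha : ∀ p, σ p = a p) {v : ℕ} (hle : ∀ p < n, rank a p ≤ v)
    (hv : v = 0 ∨ ∃ p < n, rank a p = v) : lis σ = v := by
  classical
  apply le_antisymm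
  · refine Finset.sup_le fun I hI => ?_
    simp only [Finset.mem_filter, Finset.mem_univ, true_and] at hI
    rcases I.eq_empty_or_nonempty with rfl | hne
    · simp
    · have hp := I.max'_mem hne
      have := card_filter_le_rank ha hI _ hp
      rw [Finset.filter_true_of_mem fun x hx => I.le_max' x hx] at this
      exact this.trans (hle _ (Fin.is_lt _))
  · rcases hv with rfl | ⟨p, hp, rfl⟩
    · exact Nat.zero_le _
    · obtain ⟨I, hmono, -, -, hcard⟩ := exists_strictMonoOn_card_eq_rank ha ⟨p, hp⟩
      simp only at hcard
      rw [← hcard]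
      exact Finset.le_sup (f := Finset.card) (by simpa using hmono)

end lis

/-! ### The program and a total-correctness calculus for it -/

/-- Patience sorting in windows of `2 * s + 2` consecutive piles. The word cells `0, …, 31` are
registers: `0` and `1` hold these constants, `2` holds `n`, `3` holds `s`, `4` the number of piles
in the window, `5` the address of the array of pile sizes, `6` the address of the list of positions of
the lowest pile of the window, `7` the address of the list being recorded, `8` the number of the
lowest pile, `9` the index of the first pile that is kept (`1` in the first round and `0` later),
`10` the index of the pile to be recorded, `11` the head position, `12` the number of nonempty
piles, `13` and `14` the bounds of the binary search. The entry cells hold the tops of the piles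
and, at address `2 * s + 2`, the current entry. -/
def lisProgram : Program := [
  .const 1 1, .len 2, .par 3, .add 4 3 3, .add 4 4 1, .add 4 4 1, .const 5 32, .add 6 5 4,
  .add 7 6 4, .const 9 1,
  -- 10: a round
  .add 10 4 0,
  -- 11: a pass
  .rewind, .const 11 0, .add 12 9 0, .const 15 0,
  -- 15: clear the pile sizes
  .add 16 5 15, .store 16 0, .add 15 15 1, .jlt 15 4 15,
  -- 19: the next entry
  .jlt 11 2 21, .jump 54, .take 4, .add 13 9 0, .add 14 12 0,
  -- 24: binary search
  .jlt 13 14 26, .jump 33, .add 15 13 14, .half 15 15, .cmp 15 4 31, .add 14 15 0, .jump 24,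
  .add 13 15 1, .jump 24,
  -- 33: put the entry on its pile
  .jlt 13 4 35, .jump 51, .add 16 5 13, .load 17 16, .jlt 0 13 42, .add 18 6 17, .load 18 18,
  .jlt 18 11 51, .jlt 11 18 51, .copy 13 4, .add 18 17 1, .store 16 18, .jlt 13 12 47, .add 12 12 1,
  .jlt 13 10 51, .jlt 10 13 51, .add 18 7 17, .store 18 11,
  -- 51: advance
  .advance, .add 11 11 1, .jump 19,
  -- 54: end of a pass
  .jlt 10 4 63, .jlt 12 4 73, .add 10 3 0,
  -- 57: find a small pile
  .add 16 5 10, .load 17 16, .jlt 3 17 61, .jump 11, .add 10 10 1, .jump 57,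
  -- 63: end of a recording pass
  .add 16 5 10, .load 17 16, .add 18 7 17, .store 18 2, .add 8 8 10, .add 18 6 0, .add 6 7 0,
  .add 7 18 0, .const 9 0, .jump 10,
  -- 73: answer
  .add 8 8 12, .sub 8 8 1, .out 8, .halt]

/-- The working memory suits the program and the input sequence `a`. -/
structure Fits {n : ℕ} (M : Env n) (a : ℕ → ℤ) (s : ℕ) : Prop where
  entry : ∀ p : Fin n, M.entry p = a p
  param : M.param = s
  le : s ≤ n
  sq : n ≤ s * s
  -- 32 registers and three arrays of length 2s + 2: pile sizes at 32, lists at 2s + 34 and 4s + 36.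
  cells : M.cells = 6 * s + 38
  word : ∀ v ≤ 10 * n + 100, v < 2 ^ M.wordBits

/-- Started at time `t` in the configuration `c`, the machine reaches a configuration `c'` at a
time `t'` with `Q t' c'`. -/
def Wp {n : ℕ} (M : Env n) (t : ℕ) (c : Config n) (Q : ℕ → Config n → Prop) : Prop :=
  ∃ k c', run lisProgram M k c = some c' ∧ Q (t + k) c'

section wp
variable {n : ℕ} {M : Env n} {t : ℕ} {c c' : Config n} {Q R : ℕ → Config n → Prop}

theorem Wp.done (h : Q t c) : Wp M t c Q := ⟨0, c, rfl, h⟩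

theorem Wp.step (hs : step lisProgram M c = some c') (h : Wp M (t + 1) c' Q) : Wp M t c Q := by
  obtain ⟨k, d, hk, hQ⟩ := h
  refine ⟨k + 1, d, ?_, ?_⟩
  · rw [run, hs]; exact hk
  · rwa [show t + (k + 1) = t + 1 + k by omega]

theorem run_add (P : Program) (k l : ℕ) (c : Config n) :
    run P M (k + l) c = (run P M k c).bind (run P M l) := by
  induction k generalizing c with
  | zero => simp [run]
  | succ k ih =>
    rw [show k + 1 + l = (k + l) + 1 by omega, run, run]
    cases step P M c with
    | none => rfl
    | some d => exact ih d

/-- Time in `Wp` is absolute, so time bounds chain without shifting the postconditions. -/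
theorem Wp.bind (h : Wp M t c Q) (h' : ∀ t' c', Q t' c' → Wp M t' c' R) : Wp M t c R := by
  obtain ⟨k, d, hk, hQ⟩ := h
  obtain ⟨l, e, hl, hR⟩ := h' _ _ hQ
  refine ⟨k + l, e, ?_, ?_⟩
  · rw [run_add, hk]; exact hl
  · rwa [show t + (k + l) = t + k + l by omega]

theorem Wp.mono (h : Wp M t c Q) (h' : ∀ t' c', Q t' c' → R t' c') : Wp M t c R :=
  h.bind fun t' c' hQ => .done (h' t' c' hQ)

end wp

/-! ### Rules for single instructions -/

section instructions
variable {n : ℕ} {M : Env n} {s : ℕ} {a : ℕ → ℤ} {t : ℕ}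
  {Q : ℕ → Config n → Prop} {pc : ℕ} {w : ℕ → ℕ} {e : ℕ → Option (Fin n)} {h p : ℕ} {o : List ℕ}
  {d i j l v x y : ℕ}

/-- Common core of all instructions that write a word: the only obligations are that the address
exists and that the value fits. -/
theorem wp_set (F : Fits M a s) {I : Instr}
    (hs : exec M ⟨pc, w, e, h, p, o⟩ I = setWord M ⟨pc, w, e, h, p, o⟩ d v)
    (hf : lisProgram[pc]? = some I) (hd : d < 6 * s + 38) (hv : v ≤ 10 * n + 100)
    (H : Wp M (t + 1) ⟨pc + 1, Function.update w d v, e, h, p, o⟩ Q) :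
    Wp M t ⟨pc, w, e, h, p, o⟩ Q := by
  refine Wp.step ?_ H
  have h1 := F.word v hv
  have h2 : d < M.cells := by rw [F.cells]; exact hd
  simp [step, hf, hs, setWord, h1, h2]

theorem wp_const (F : Fits M a s) (hf : lisProgram[pc]? = some (.const d v)) (hr : d < 32 ∧ v < 100)
    (H : Wp M (t + 1) ⟨pc + 1, Function.update w d v, e, h, p, o⟩ Q) :
    Wp M t ⟨pc, w, e, h, p, o⟩ Q :=
  wp_set F rfl hf (by omega) (by omega) H

theorem wp_len (F : Fits M a s) (hf : lisProgram[pc]? = some (.len d)) (hr : d < 32)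
    (H : Wp M (t + 1) ⟨pc + 1, Function.update w d n, e, h, p, o⟩ Q) :
    Wp M t ⟨pc, w, e, h, p, o⟩ Q :=
  wp_set F rfl hf (by omega) (by omega) H

theorem wp_par (F : Fits M a s) (hf : lisProgram[pc]? = some (.par d)) (hr : d < 32)
    (H : Wp M (t + 1) ⟨pc + 1, Function.update w d s, e, h, p, o⟩ Q) :
    Wp M t ⟨pc, w, e, h, p, o⟩ Q :=
  wp_set F (by rw [exec, F.param]) hf (by omega) (by have := F.le; omega) H

theorem getWord_eq (F : Fits M a s) {c : Config n} (hi : i < 6 * s + 38) : getWord M c i = some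
    (c.words i) := by
  rw [getWord, if_pos (by rw [F.cells]; exact hi)]

theorem wp_add (F : Fits M a s) (hf : lisProgram[pc]? = some (.add d i j))
    (hr : d < 32 ∧ i < 32 ∧ j < 32)
    (hx : w i = x) (hy : w j = y) (hv : x + y ≤ 10 * n + 100)
    (H : Wp M (t + 1) ⟨pc + 1, Function.update w d (x + y), e, h, p, o⟩ Q) :
    Wp M t ⟨pc, w, e, h, p, o⟩ Q :=
  wp_set F (by simp [exec, getWord_eq F (show i < 6 * s + 38 by omega),
    getWord_eq F (show j < 6 * s + 38 by omega), hx, hy]) hf (by omega) hv H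

theorem wp_sub (F : Fits M a s) (hf : lisProgram[pc]? = some (.sub d i j))
    (hr : d < 32 ∧ i < 32 ∧ j < 32)
    (hx : w i = x) (hy : w j = y) (hv : x - y ≤ 10 * n + 100)
    (H : Wp M (t + 1) ⟨pc + 1, Function.update w d (x - y), e, h, p, o⟩ Q) :
    Wp M t ⟨pc, w, e, h, p, o⟩ Q :=
  wp_set F (by simp [exec, getWord_eq F (show i < 6 * s + 38 by omega),
    getWord_eq F (show j < 6 * s + 38 by omega), hx, hy]) hf (by omega) hv H

theorem wp_half (F : Fits M a s) (hf : lisProgram[pc]? = some (.half d i)) (hr : d < 32 ∧ i < 32)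
    (hx : w i = x) (hv : x / 2 ≤ 10 * n + 100)
    (H : Wp M (t + 1) ⟨pc + 1, Function.update w d (x / 2), e, h, p, o⟩ Q) :
    Wp M t ⟨pc, w, e, h, p, o⟩ Q :=
  wp_set F (by simp [exec, getWord_eq F (show i < 6 * s + 38 by omega), hx]) hf (by omega) hv H

theorem wp_load (F : Fits M a s) (hf : lisProgram[pc]? = some (.load d i)) (hr : d < 32 ∧ i < 32)
    (hx : w i = x) (hy : w x = y) (hl : x < 6 * s + 38) (hv : y ≤ 10 * n + 100)
    (H : Wp M (t + 1) ⟨pc + 1, Function.update w d y, e, h, p, o⟩ Q) :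
    Wp M t ⟨pc, w, e, h, p, o⟩ Q :=
  wp_set F (by simp [exec, getWord_eq F (show i < 6 * s + 38 by omega), getWord_eq F hl, hx, hy])
    hf (by omega) hv H

theorem wp_store (F : Fits M a s) (hf : lisProgram[pc]? = some (.store d i)) (hr : d < 32 ∧ i < 32)
    (hx : w d = x) (hy : w i = y) (hl : x < 6 * s + 38) (hv : y ≤ 10 * n + 100)
    (H : Wp M (t + 1) ⟨pc + 1, Function.update w x y, e, h, p, o⟩ Q) :
    Wp M t ⟨pc, w, e, h, p, o⟩ Q :=
  wp_set F (by simp [exec, getWord_eq F (show i < 6 * s + 38 by omega),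
    getWord_eq F (show d < 6 * s + 38 by omega), hx, hy]) hf hl hv H

theorem wp_jump (hf : lisProgram[pc]? = some (.jump l))
    (H : Wp M (t + 1) ⟨l, w, e, h, p, o⟩ Q) : Wp M t ⟨pc, w, e, h, p, o⟩ Q :=
  Wp.step (by simp [step, hf, exec, goto]) H

theorem wp_jlt (F : Fits M a s) (hf : lisProgram[pc]? = some (.jlt i j l)) (hr : i < 32 ∧ j < 32)
    (hx : w i = x) (hy : w j = y)
    (H : x < y → Wp M (t + 1) ⟨l, w, e, h, p, o⟩ Q)
    (H' : ¬ x < y → Wp M (t + 1) ⟨pc + 1, w, e, h, p, o⟩ Q) :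
    Wp M t ⟨pc, w, e, h, p, o⟩ Q := by
  by_cases hxy : x < y
  · refine Wp.step ?_ (H hxy)
    simp [step, hf, exec, getWord_eq F (show i < 6 * s + 38 by omega),
      getWord_eq F (show j < 6 * s + 38 by omega), hx, hy, hxy, goto]
  · refine Wp.step ?_ (H' hxy)
    simp [step, hf, exec, getWord_eq F (show i < 6 * s + 38 by omega),
      getWord_eq F (show j < 6 * s + 38 by omega), hx, hy, hxy, goto]

theorem wp_advance (hf : lisProgram[pc]? = some .advance) (hh : h < n)
    (H : Wp M (t + 1) ⟨pc + 1, w, e, h + 1, p, o⟩ Q) : Wp M t ⟨pc, w, e, h, p, o⟩ Q :=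
  Wp.step (by simp [step, hf, exec, hh]) H

theorem wp_rewind (hf : lisProgram[pc]? = some .rewind)
    (H : Wp M (t + 1) ⟨pc + 1, w, e, 0, p + 1, o⟩ Q) : Wp M t ⟨pc, w, e, h, p, o⟩ Q :=
  Wp.step (by simp [step, hf, exec]) H

theorem wp_take (F : Fits M a s) (hf : lisProgram[pc]? = some (.take d)) (hr : d < 32)
    (hx : w d = x)
    (hl : x < 6 * s + 38) (hh : h < n)
    (H : Wp M (t + 1) ⟨pc + 1, w, Function.update e x (some ⟨h, hh⟩), h, p, o⟩ Q) :
    Wp M t ⟨pc, w, e, h, p, o⟩ Q :=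
  Wp.step (by simp [step, hf, exec, getWord_eq F (show d < 6 * s + 38 by omega), hx, current, hh,
    setEntry, F.cells, hl]) H

theorem wp_copy (F : Fits M a s) {q : Fin n} (hf : lisProgram[pc]? = some (.copy d i))
    (hr : d < 32 ∧ i < 32)
    (hx : w d = x) (hy : w i = y) (hl : x < 6 * s + 38 ∧ y < 6 * s + 38) (he : e y = some q)
    (H : Wp M (t + 1) ⟨pc + 1, w, Function.update e x (some q), h, p, o⟩ Q) :
    Wp M t ⟨pc, w, e, h, p, o⟩ Q :=
  Wp.step (by simp [step, hf, exec, getWord_eq F (show d < 6 * s + 38 by omega),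
    getWord_eq F (show i < 6 * s + 38 by omega), hx, hy, getEntry, setEntry, F.cells, hl, he]) H

theorem wp_cmp (F : Fits M a s) {q r : Fin n} (hf : lisProgram[pc]? = some (.cmp i j l))
    (hr : i < 32 ∧ j < 32)
    (hx : w i = x) (hy : w j = y) (hl : x < 6 * s + 38 ∧ y < 6 * s + 38) (hq : e x = some q)
    (hr' : e y = some r)
    (H : a q < a r → Wp M (t + 1) ⟨l, w, e, h, p, o⟩ Q)
    (H' : ¬ a q < a r → Wp M (t + 1) ⟨pc + 1, w, e, h, p, o⟩ Q) :
    Wp M t ⟨pc, w, e, h, p, o⟩ Q := by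
  by_cases hxy : a q < a r
  · refine Wp.step ?_ (H hxy)
    simp [step, hf, exec, getWord_eq F (show i < 6 * s + 38 by omega),
      getWord_eq F (show j < 6 * s + 38 by omega), hx, hy, getEntry, F.cells, hl, hq, hr', hxy,
      F.entry, goto]
  · refine Wp.step ?_ (H' hxy)
    simp [step, hf, exec, getWord_eq F (show i < 6 * s + 38 by omega),
      getWord_eq F (show j < 6 * s + 38 by omega), hx, hy, getEntry, F.cells, hl, hq, hr', hxy,
      F.entry, goto]

theorem wp_out (F : Fits M a s) (hf : lisProgram[pc]? = some (.out i)) (hr : i < 32) (hx : w i = x)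
    (H : Wp M (t + 1) ⟨pc + 1, w, e, h, p, o ++ [x]⟩ Q) : Wp M t ⟨pc, w, e, h, p, o⟩ Q :=
  Wp.step (by simp [step, hf, exec, getWord_eq F (show i < 6 * s + 38 by omega), hx]) H

end instructions

/-! ### Binary search among the tops -/

section search
variable {n : ℕ} {M : Env n} {s : ℕ} {a : ℕ → ℤ}

/-- Loop invariant: tops below `lo` are smaller than the current entry, tops from `hi` on are not.
The gap `hi - lo` is below 2^g and at least halves in each iteration of six instructions. -/
theorem wp_search (F : Fits M a s) {e : ℕ → Option (Fin n)} {h p : ℕ} {o : List ℕ} {x : Fin n}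
    {L c : ℕ} (hx : e (2 * s + 2) = some x) (hc : c ≤ 2 * s + 2)
    (htop : ∀ i, L ≤ i → i < c → ∃ q, e i = some q)
    (hmono : ∀ i i' q q', L ≤ i → i < i' → i' < c → e i = some q → e i' = some q' → a q < a q')
    (g : ℕ) {t lo hi : ℕ} {w : ℕ → ℕ} (h0 : w 0 = 0) (h1 : w 1 = 1) (h4 : w 4 = 2 * s + 2)
    (h13 : w 13 = lo) (h14 : w 14 = hi) (hL : L ≤ lo) (hle : lo ≤ hi) (hhc : hi ≤ c)
    (hg : hi - lo < 2 ^ g)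
    (hlo : ∀ i q, L ≤ i → i < lo → e i = some q → a q < a x)
    (hhi : ∀ i q, hi ≤ i → i < c → e i = some q → a x ≤ a q) :
    Wp M t ⟨24, w, e, h, p, o⟩ fun t' c' => t' ≤ t + 6 * g + 2 ∧ ∃ w' k,
      c' = ⟨33, w', e, h, p, o⟩ ∧ (∀ r, r < 13 ∨ 15 < r → w' r = w r) ∧ w' 13 = k ∧
      L ≤ k ∧ k ≤ c ∧ (∀ i q, L ≤ i → i < k → e i = some q → a q < a x) ∧
      (∀ i q, k ≤ i → i < c → e i = some q → a x ≤ a q) := by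
  have hsn := F.le
  induction g generalizing t lo hi w with
  | zero =>
    refine wp_jlt F rfl (by decide) h13 h14 (fun hlt => by omega) fun _ => ?_
    refine wp_jump rfl (.done ⟨by omega, w, lo, rfl, fun _ _ => rfl, h13, hL, by omega, hlo, ?_⟩)
    have : lo = hi := by omega
    rwa [this]
  | succ g ih =>
    rw [pow_succ] at hg
    refine wp_jlt F rfl (by decide) h13 h14 (fun hlt => ?_) fun hge => ?_
    · obtain ⟨q, hq⟩ := htop ((lo + hi) / 2) (by omega) (by omega)
      refine wp_add F rfl (by decide) h13 h14 (by omega) ?_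
      refine wp_half F rfl (by decide) (Function.update_self ..) (by omega) ?_
      rw [Function.update_idem]
      refine wp_cmp F rfl (by decide) (Function.update_self ..) (y := 2 * s + 2) (by simp [h4])
        (by omega) hq hx (fun hlt' => ?_) fun hge' => ?_
      · refine wp_add F rfl (by decide) (Function.update_self ..) (y := 1) (by simp [h1])
          (by omega) ?_
        refine wp_jump rfl ((ih (lo := (lo + hi) / 2 + 1) (hi := hi) (by simp [h0]) (by simp [h1])
          (by simp [h4]) (by simp) (by simp [h14]) (by omega) (by omega) hhc (by omega)
          (fun i r hi1 hi2 hr => ?_) hhi).mono ?_)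
        · rcases (show i ≤ (lo + hi) / 2 by omega).eq_or_lt with rfl | hl
          · rw [hq, Option.some.injEq] at hr
            rwa [← hr]
          · exact (hmono _ _ _ _ hi1 hl (by omega) hr hq).trans hlt'
        · rintro t' c' ⟨ht, w', k, rfl, hw, hk⟩
          refine ⟨by omega, w', k, rfl, fun r hr => ?_, hk⟩
          rw [hw r hr, Function.update_of_ne (by omega), Function.update_of_ne (by omega)]
      · refine wp_add F rfl (by decide) (Function.update_self ..) (y := 0) (by simp [h0])
          (by omega) ?_
        refine wp_jump rfl ((ih (lo := lo) (hi := (lo + hi) / 2) (by simp [h0]) (by simp [h1])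
          (by simp [h4]) (by simp [h13]) (by simp) hL (by omega) (by omega) (by omega)
          hlo (fun i r hi1 hi2 hr => ?_)).mono ?_)
        · rcases hi1.eq_or_lt with rfl | hl
          · rw [hq, Option.some.injEq] at hr
            rw [← hr]
            exact not_lt.1 hge'
          · exact (not_lt.1 hge').trans (hmono _ _ _ _ (by omega) hl hi2 hq hr).le
        · rintro t' c' ⟨ht, w', k, rfl, hw, hk⟩
          refine ⟨by omega, w', k, rfl, fun r hr => ?_, hk⟩
          rw [hw r hr, Function.update_of_ne (by omega), Function.update_of_ne (by omega)]
    · refine wp_jump rfl (.done ⟨by omega, w, lo, rfl, fun _ _ => rfl, h13, hL, by omega, hlo, ?_⟩)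
      have : lo = hi := by omega
      rwa [this]

end search

/-! ### Invariants of a pass -/

/-- The parameters of a pass: the lowest pile `low` of the window, the index `first` of the first
pile that is kept, the index `target` of the pile to be recorded, and the addresses of the list of
the positions of the pile `low` and of the list being recorded. -/
structure PassData where
  low : ℕ
  first : ℕ
  target : ℕ
  src : ℕ
  dst : ℕ

/-- The target 2s + 2 matches no pile index, so it encodes a counting pass that records nothing. The
bounds s on pile sizes keep each list, with its sentinel, inside its buffer. -/
structure PassData.Valid (D : PassData) (a : ℕ → ℤ) (n s : ℕ) : Prop where
  first : D.low = 0 ∧ D.first = 1 ∨ 0 < D.low ∧ D.first = 0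
  buffers : D.src = 2 * s + 34 ∧ D.dst = 4 * s + 36 ∨ D.src = 4 * s + 36 ∧ D.dst = 2 * s + 34
  exists_low : 0 < D.low → ∃ p < n, rank a p = D.low
  count_low : 0 < D.low → pileCount a D.low n ≤ s
  target : D.target = 2 * s + 2 ∨ s ≤ D.target ∧ D.target < 2 * s + 2 ∧
    pileCount a (D.low + D.target) n ≤ s ∧ ∃ p < n, rank a p = D.low + D.target

/-- The contents of the working memory that do not change during a pass. -/
structure Frame (a : ℕ → ℤ) (n s : ℕ) (D : PassData) (w : ℕ → ℕ) : Prop where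
  r0 : w 0 = 0
  r1 : w 1 = 1
  r2 : w 2 = n
  r3 : w 3 = s
  r4 : w 4 = 2 * s + 2
  r5 : w 5 = 32
  r6 : w 6 = D.src
  r7 : w 7 = D.dst
  r8 : w 8 = D.low
  r9 : w 9 = D.first
  r10 : w 10 = D.target
  src : 0 < D.low → ∀ j < n, w (D.src + pileCount a D.low j) ≤ n ∧
    (w (D.src + pileCount a D.low j) = j ↔ rank a j = D.low)

theorem Frame.congr {a : ℕ → ℤ} {n s : ℕ} {D : PassData} {w w' : ℕ → ℕ} (h : Frame a n s D w)
    (hreg : ∀ r ≤ 10, w' r = w r)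
    (hsrc : 0 < D.low → ∀ j < n,
      w' (D.src + pileCount a D.low j) = w (D.src + pileCount a D.low j)) :
    Frame a n s D w' where
  r0 := by rw [hreg _ (by decide), h.r0]
  r1 := by rw [hreg _ (by decide), h.r1]
  r2 := by rw [hreg _ (by decide), h.r2]
  r3 := by rw [hreg _ (by decide), h.r3]
  r4 := by rw [hreg _ (by decide), h.r4]
  r5 := by rw [hreg _ (by decide), h.r5]
  r6 := by rw [hreg _ (by decide), h.r6]
  r7 := by rw [hreg _ (by decide), h.r7]
  r8 := by rw [hreg _ (by decide), h.r8]
  r9 := by rw [hreg _ (by decide), h.r9]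
  r10 := by rw [hreg _ (by decide), h.r10]
  src := fun hb j hj => by rw [hsrc hb j hj]; exact h.src hb j hj

/-- The state of the piles after the first `j` entries; `c` is the index of the first empty pile. -/
structure Piles (a : ℕ → ℤ) (s : ℕ) (D : PassData) (j c : ℕ) {n : ℕ}
    (e : ℕ → Option (Fin n)) : Prop where
  first_le : D.first ≤ c
  le : c ≤ 2 * s + 2
  lt_of_rank : ∀ p < j, ∀ i < 2 * s + 2, rank a p = D.low + i → i < c
  top : ∀ i, D.first ≤ i → i < c → ∃ q : Fin n, e i = some q ∧ q < j ∧ rank a q = D.low + i ∧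
    ∀ p < j, rank a p = D.low + i → p ≤ q

/-- The sizes of the piles and the recorded list after the first `j` entries. -/
structure Counts (a : ℕ → ℤ) (s : ℕ) (D : PassData) (j : ℕ) (w : ℕ → ℕ) : Prop where
  size : ∀ i < 2 * s + 2, w (32 + i) = pileCount a (D.low + i) j
  dst : D.target < 2 * s + 2 → ∀ p < j, rank a p = D.low + D.target →
    w (D.dst + pileCount a (D.low + D.target) p) = p

theorem Counts.congr {a : ℕ → ℤ} {s : ℕ} {D : PassData} {j : ℕ} {w w' : ℕ → ℕ}
    (h : Counts a s D j w) (hw : ∀ r, 32 ≤ r → w' r = w r) (hd : 32 ≤ D.dst) :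
    Counts a s D j w' where
  size i hi := by rw [hw _ (by omega), h.size i hi]
  dst ht p hp hr := by rw [hw _ (by omega), h.dst ht p hp hr]

section piles
variable {n : ℕ} {a : ℕ → ℤ} {s : ℕ} {D : PassData} {j c : ℕ} {e : ℕ → Option (Fin n)}

theorem Piles.congr {e' : ℕ → Option (Fin n)} (h : Piles a s D j c e)
    (he : ∀ i < 2 * s + 2, e' i = e i) : Piles a s D j c e' where
  first_le := h.first_le
  le := h.le
  lt_of_rank := h.lt_of_rank
  top i hi hic := by
    have := h.le
    rw [he i (by omega)]
    exact h.top i hi hic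

theorem Piles.init (hf : D.first ≤ 2 * s + 2) : Piles a s D 0 D.first e where
  first_le := le_rfl
  le := hf
  lt_of_rank p hp := absurd hp (Nat.not_lt_zero _)
  top i hi hic := by omega

/-- The higher top has an earlier, smaller predecessor in the lower pile, and the top of that pile
is at most this predecessor. The lower rank must be positive, which is why index 0 is excluded when
`low` is 0. -/
theorem Piles.strictMono (hD : D.Valid a n s) (h : Piles a s D j c e) (i i' : ℕ) (q q' : Fin n)
    (hi : D.first ≤ i) (hii : i < i') (hc : i' < c) (hq : e i = some q) (hq' : e i' = some q') :
    a q < a q' := by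
  obtain ⟨r, hr, hrj, hrr, hmax⟩ := h.top i hi (hii.trans hc)
  obtain ⟨r', hr', hrj', hrr', -⟩ := h.top i' (hi.trans hii.le) hc
  rw [hq, Option.some.injEq] at hr
  rw [hq', Option.some.injEq] at hr'
  subst hr hr'
  have := hD.first
  obtain ⟨p, hp, hlt, hpr⟩ := exists_rank_eq (a := a) (j := q') (k := D.low + i) (by omega)
    (by omega)
  exact (le_of_rank_eq (hmax p (by omega) hpr) (by omega)).trans_lt hlt

/-- The number of tops that are smaller than the next entry determines its rank. -/
theorem Piles.rank_eq (hD : D.Valid a n s) (h : Piles a s D j c e) {k : ℕ} (hk : D.first ≤ k)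
    (hkc : k ≤ c) (hlo : ∀ i q, D.first ≤ i → i < k → e i = some q → a q < a j)
    (hhi : ∀ i q, k ≤ i → i < c → e i = some q → a j ≤ a q) :
    (0 < k → D.low + k ≤ rank a j) ∧ (k < 2 * s + 2 → rank a j ≤ D.low + k) := by
  have hf := hD.first
  constructor
  · intro hk0
    rcases hk.eq_or_lt with he | hlt
    -- Here `first` is 1 and `low` is 0, so the claim is positivity of the rank.
    · have := rank_pos (a := a) j
      omega
    · obtain ⟨q, hq, hqj, hqr, -⟩ := h.top (k - 1) (by omega) (by omega)
      have := rank_lt_rank hqj (hlo _ _ (by omega) (by omega) hq)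
      omega
  · intro hkK
    -- A higher rank would give an earlier, smaller entry in pile k; the top of that pile would then
    -- be smaller than the new entry, contrary to `hhi`.
    by_contra hc
    obtain ⟨p, hp, hlt, hpr⟩ := exists_rank_eq (a := a) (j := j) (k := D.low + k) (by omega)
      (by omega)
    have hkc' := h.lt_of_rank p hp k hkK hpr
    obtain ⟨q, hq, hqj, hqr, hmax⟩ := h.top k hk hkc'
    have h1 := hhi k q le_rfl hkc' hq
    have h2 := le_of_rank_eq (a := a) (hmax p hp hpr) (by omega)
    exact absurd hlt (not_lt.2 (h1.trans h2))

theorem Piles.skip (h : Piles a s D j c e)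
    (hr : ∀ i < 2 * s + 2, rank a j ≠ D.low + i) : Piles a s D (j + 1) c e where
  first_le := h.first_le
  le := h.le
  lt_of_rank p hp i hi hpi := by
    rcases (Nat.lt_succ_iff.1 hp).eq_or_lt with rfl | hlt
    · exact absurd hpi (hr i hi)
    · exact h.lt_of_rank p hlt i hi hpi
  top i hi hic := by
    obtain ⟨q, hq, hqj, hqr, hmax⟩ := h.top i hi hic
    refine ⟨q, hq, by omega, hqr, fun p hp hpr => ?_⟩
    rcases (Nat.lt_succ_iff.1 hp).eq_or_lt with rfl | hlt
    · exact absurd hpr (hr i (by have := h.le; omega))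
    · exact hmax p hlt hpr

theorem Piles.push (h : Piles a s D j c e) (hj : j < n) {k : ℕ} (hk : D.first ≤ k) (hkc : k ≤ c)
    (hkK : k < 2 * s + 2) (hr : rank a j = D.low + k) :
    Piles a s D (j + 1) (max c (k + 1)) (Function.update e k (some ⟨j, hj⟩)) where
  first_le := h.first_le.trans (le_max_left _ _)
  le := max_le h.le hkK
  lt_of_rank p hp i hi hpi := by
    rcases (Nat.lt_succ_iff.1 hp).eq_or_lt with rfl | hlt
    · omega
    · exact (h.lt_of_rank p hlt i hi hpi).trans_le (le_max_left _ _)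
  top i hi hic := by
    by_cases hik : i = k
    · subst hik
      exact ⟨⟨j, hj⟩, by simp, by simp, hr, fun p hp _ => Nat.lt_succ_iff.1 hp⟩
    · obtain ⟨q, hq, hqj, hqr, hmax⟩ := h.top i hi (by omega)
      refine ⟨q, by rw [Function.update_of_ne hik, hq], by omega, hqr, fun p hp hpr => ?_⟩
      rcases (Nat.lt_succ_iff.1 hp).eq_or_lt with rfl | hlt
      · omega
      · exact hmax p hlt hpr

theorem Counts.skip {w : ℕ → ℕ} (h : Counts a s D j w)
    (hr : ∀ i < 2 * s + 2, rank a j ≠ D.low + i) : Counts a s D (j + 1) w where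
  size i hi := by rw [pileCount_succ, if_neg (hr i hi), h.size i hi, Nat.add_zero]
  dst ht p hp hpr := by
    rcases (Nat.lt_succ_iff.1 hp).eq_or_lt with rfl | hlt
    · exact absurd hpr (hr _ ht)
    · exact h.dst ht p hlt hpr

end piles

/-- The state of a pass after the first `j` entries. -/
structure PassState (a : ℕ → ℤ) (n s : ℕ) (D : PassData) (j c : ℕ) (w : ℕ → ℕ)
    (e : ℕ → Option (Fin n)) : Prop where
  frame : Frame a n s D w
  pos : w 11 = j
  count : w 12 = c
  piles : Piles a s D j c e
  counts : Counts a s D j w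

/-! ### Correctness and running time of one pass -/

section pass
variable {n : ℕ} {M : Env n} {s : ℕ} {a : ℕ → ℤ} {D : PassData} {t j c p : ℕ} {w : ℕ → ℕ}
  {e : ℕ → Option (Fin n)} {o : List ℕ}

theorem wp_next (F : Fits M a s) (hj : j < n) (hD : D.Valid a n s) (hf : Frame a n s D w)
    (h11 : w 11 = j) (h12 : w 12 = c) (hp : Piles a s D (j + 1) c e)
    (hc : Counts a s D (j + 1) w) :
    Wp M t ⟨51, w, e, j, p, o⟩ fun t' c' => t' ≤ t + 3 ∧ ∃ w' e' k,
      c' = ⟨19, w', e', j + 1, p, o⟩ ∧ PassState a n s D (j + 1) k w' e' := by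
  have hbuf := hD.buffers
  refine wp_advance rfl hj ?_
  refine wp_add F rfl (by decide) h11 hf.r1 (by omega) ?_
  refine wp_jump rfl (.done ⟨le_rfl, _, _, c, rfl, ?_, ?_, ?_, hp, ?_⟩)
  · exact hf.congr (fun r hr => Function.update_of_ne (by omega) _ _)
      fun _ _ _ => Function.update_of_ne (by omega) _ _
  · simp
  · simp [h12]
  · exact hc.congr (fun r hr => Function.update_of_ne (by omega) _ _) (by omega)

/-- Equality with the target is tested by two strict comparisons. Register 17 still holds the size
before the push, which is the index of the new list element. -/
theorem wp_record (F : Fits M a s) (hj : j < n) (hD : D.Valid a n s) (hf : Frame a n s D w)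
    (h11 : w 11 = j) (h12 : w 12 = c) {k : ℕ} (h13 : w 13 = k)
    (h17 : w 17 = pileCount a (D.low + k) j)
    (hr : rank a j = D.low + k) (hp : Piles a s D (j + 1) c e)
    (hsize : ∀ i < 2 * s + 2, w (32 + i) = pileCount a (D.low + i) (j + 1))
    (hdst : D.target < 2 * s + 2 → ∀ p < j, rank a p = D.low + D.target →
      w (D.dst + pileCount a (D.low + D.target) p) = p) (hk : k < 2 * s + 2) :
    Wp M t ⟨47, w, e, j, p, o⟩ fun t' c' => t' ≤ t + 7 ∧ ∃ w' e' k,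
      c' = ⟨19, w', e', j + 1, p, o⟩ ∧ PassState a n s D (j + 1) k w' e' := by
  have hbuf := hD.buffers
  have hsn := F.le
  have hne : k ≠ D.target → Counts a s D (j + 1) w := fun hne =>
    ⟨hsize, fun ht q hq hqr => by
      rcases (Nat.lt_succ_iff.1 hq).eq_or_lt with rfl | hlt
      · omega
      · exact hdst ht q hlt hqr⟩
  refine wp_jlt F rfl (by decide) h13 hf.r10 (fun hlt => ?_) fun hge => ?_
  · refine (wp_next F hj hD hf h11 h12 hp (hne (by omega))).mono ?_
    rintro t' c' ⟨ht, h⟩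
    exact ⟨by omega, h⟩
  refine wp_jlt F rfl (by decide) hf.r10 h13 (fun hlt => ?_) fun hge' => ?_
  · refine (wp_next F hj hD hf h11 h12 hp (hne (by omega))).mono ?_
    rintro t' c' ⟨ht, h⟩
    exact ⟨by omega, h⟩
  obtain rfl : k = D.target := by omega
  have hcount : pileCount a (D.low + D.target) n ≤ s := by
    rcases hD.target with h | h
    · omega
    · exact h.2.2.1
  have hv := (pileCount_mono (a := a) (D.low + D.target) hj.le).trans hcount
  refine wp_add F rfl (by decide) hf.r7 h17 (by omega) ?_
  refine wp_store F rfl (by decide) (Function.update_self ..) (y := j) (by simp [h11]) (by omega)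
    (by omega) ?_
  refine (wp_next (c := c) F hj hD ?_ ?_ ?_ hp ?_).mono ?_
  · refine hf.congr (fun r hr => ?_) fun hb i hi => ?_
    · rw [Function.update_of_ne (by omega), Function.update_of_ne (by omega)]
    -- The consulted list uses only offsets up to s, so writing to the other buffer does not touch
    -- it.
    · have := (pileCount_mono (a := a) D.low hi.le).trans (hD.count_low hb)
      rw [Function.update_of_ne (by omega), Function.update_of_ne (by omega)]
  · rw [Function.update_of_ne (by omega), Function.update_of_ne (by omega), h11]
  · rw [Function.update_of_ne (by omega), Function.update_of_ne (by omega), h12]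
  · refine ⟨fun i hi => ?_, fun ht q hq hqr => ?_⟩
    · rw [Function.update_of_ne (by omega), Function.update_of_ne (by omega), hsize i hi]
    · rcases (Nat.lt_succ_iff.1 hq).eq_or_lt with rfl | hlt
      · exact Function.update_self ..
      · have := pileCount_lt hlt hqr
        rw [Function.update_of_ne (by omega), Function.update_of_ne (by omega), hdst ht q hlt hqr]
  · rintro t' c' ⟨ht, h⟩
    exact ⟨by omega, h⟩

theorem pileCount_le (k j : ℕ) : pileCount a k j ≤ j :=
  Nat.count_le _

theorem wp_push (F : Fits M a s) (hj : j < n) (hD : D.Valid a n s) (hf : Frame a n s D w)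
    (h11 : w 11 = j) (h12 : w 12 = c) {k : ℕ} (h13 : w 13 = k) (h16 : w 16 = 32 + k)
    (h17 : w 17 = pileCount a (D.low + k) j) (hx : e (2 * s + 2) = some ⟨j, hj⟩)
    (hr : rank a j = D.low + k) (hp : Piles a s D j c e) (hc : Counts a s D j w)
    (hfk : D.first ≤ k) (hkc : k ≤ c) (hk : k < 2 * s + 2) :
    Wp M t ⟨42, w, e, j, p, o⟩ fun t' c' => t' ≤ t + 12 ∧ ∃ w' e' k,
      c' = ⟨19, w', e', j + 1, p, o⟩ ∧ PassState a n s D (j + 1) k w' e' := by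
  have hbuf := hD.buffers
  have hsn := F.le
  have hv := pileCount_le (a := a) (D.low + k) j
  have hcK := hp.le
  have hpush := hp.push hj hfk hkc hk hr
  refine wp_copy F rfl (by decide) h13 hf.r4 (by omega) hx ?_
  refine wp_add F rfl (by decide) h17 hf.r1 (by omega) ?_
  refine wp_store F rfl (by decide) (x := 32 + k) (by simp [h16]) (Function.update_self ..)
    (by omega) (by omega) ?_
  have hw : ∀ r, r < 18 ∨ 32 ≤ r → r ≠ 32 + k →
      Function.update (Function.update w 18 (pileCount a (D.low + k) j + 1)) (32 + k)
        (pileCount a (D.low + k) j + 1) r = w r := fun r hr1 hr2 => by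
    rw [Function.update_of_ne hr2, Function.update_of_ne (by omega)]
  have hwk : Function.update (Function.update w 18 (pileCount a (D.low + k) j + 1)) (32 + k)
      (pileCount a (D.low + k) j + 1) (32 + k) = pileCount a (D.low + k) j + 1 :=
    Function.update_self ..
  generalize Function.update (Function.update w 18 (pileCount a (D.low + k) j + 1)) (32 + k)
      (pileCount a (D.low + k) j + 1) = w₁ at hw hwk ⊢
  have hf₁ : Frame a n s D w₁ := hf.congr (fun r hr => hw r (by omega) (by omega))
    fun _ _ _ => hw _ (by omega) (by omega)
  have hsize : ∀ i < 2 * s + 2, w₁ (32 + i) = pileCount a (D.low + i) (j + 1) := fun i hi => by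
    by_cases hik : i = k
    · rw [hik, hwk, pileCount_succ, if_pos hr]
    · rw [hw _ (by omega) (by omega), hc.size i hi, pileCount_succ, if_neg (by omega),
        Nat.add_zero]
  have hdst : D.target < 2 * s + 2 → ∀ p < j, rank a p = D.low + D.target →
      w₁ (D.dst + pileCount a (D.low + D.target) p) = p := fun ht q hq hqr => by
    rw [hw _ (by omega) (by omega), hc.dst ht q hq hqr]
  have e11 : w₁ 11 = j := by rw [hw _ (by omega) (by omega), h11]
  have e12 : w₁ 12 = c := by rw [hw _ (by omega) (by omega), h12]
  have e13 : w₁ 13 = k := by rw [hw _ (by omega) (by omega), h13]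
  have e17 : w₁ 17 = pileCount a (D.low + k) j := by rw [hw _ (by omega) (by omega), h17]
  refine wp_jlt F rfl (by decide) e13 e12 (fun hlt => ?_) fun hge => ?_
  · rw [max_eq_left (show k + 1 ≤ c by omega)] at hpush
    refine (wp_record F hj hD hf₁ e11 e12 e13 e17 hr hpush hsize hdst hk).mono ?_
    rintro t' c' ⟨ht, h⟩
    exact ⟨by omega, h⟩
  · rw [max_eq_right (show c ≤ k + 1 by omega)] at hpush
    obtain rfl : k = c := by omega
    refine wp_add F rfl (by decide) e12 hf₁.r1 (by omega) ?_
    refine (wp_record (k := k) F hj hD ?_ ?_ ?_ ?_ ?_ hr hpush ?_ ?_ hk).mono ?_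
    · exact hf₁.congr (fun r hr => Function.update_of_ne (by omega) _ _)
        fun _ _ _ => Function.update_of_ne (by omega) _ _
    · simp [e11]
    · simp
    · simp [e13]
    · simp [e17]
    · intro i hi
      rw [Function.update_of_ne (by omega), hsize i hi]
    · intro ht q hq hqr
      rw [Function.update_of_ne (by omega), hdst ht q hq hqr]
    · rintro t' c' ⟨ht, h⟩
      exact ⟨by omega, h⟩

/-- Three cases. If k = 2s + 2, the rank is above the window. If 0 < k < 2s + 2, the search has
determined the rank. If k = 0, only rank ≤ `low` is known, and the list decides whether the entry is
pushed or skipped. -/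
theorem wp_place (F : Fits M a s) (hj : j < n) (hD : D.Valid a n s) (h : PassState a n s D j c w e)
    {k : ℕ} (h13 : w 13 = k) (hx : e (2 * s + 2) = some ⟨j, hj⟩)
    (hfk : D.first ≤ k) (hkc : k ≤ c)
    (hlo : ∀ i q, D.first ≤ i → i < k → e i = some q → a q < a j)
    (hhi : ∀ i q, k ≤ i → i < c → e i = some q → a j ≤ a q) :
    Wp M t ⟨33, w, e, j, p, o⟩ fun t' c' => t' ≤ t + 20 ∧ ∃ w' e' k,
      c' = ⟨19, w', e', j + 1, p, o⟩ ∧ PassState a n s D (j + 1) k w' e' := by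
  obtain ⟨hf, h11, h12, hp, hc⟩ := h
  have hbuf := hD.buffers
  have hfirst := hD.first
  have hsn := F.le
  have hv := pileCount_le (a := a) (D.low + k) j
  have hcK := hp.le
  have hpos := rank_pos (a := a) j
  obtain ⟨hge, hle⟩ := hp.rank_eq hD hfk hkc hlo hhi
  refine wp_jlt F rfl (by decide) h13 hf.r4 (fun hlt => ?_) fun hnlt => ?_
  · refine wp_add F rfl (by decide) hf.r5 h13 (by omega) ?_
    refine wp_load F rfl (by decide) (Function.update_self ..) (y := pileCount a (D.low + k) j)
      (by rw [Function.update_of_ne (by omega), hc.size k hlt]) (by omega) (by omega) ?_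
    have hw : ∀ r, r < 16 ∨ 17 < r → Function.update (Function.update w 16 (32 + k)) 17
        (pileCount a (D.low + k) j) r = w r := fun r hr => by
      rw [Function.update_of_ne (by omega), Function.update_of_ne (by omega)]
    have e16 : Function.update (Function.update w 16 (32 + k)) 17
        (pileCount a (D.low + k) j) 16 = 32 + k := by simp
    have e17 : Function.update (Function.update w 16 (32 + k)) 17
        (pileCount a (D.low + k) j) 17 = pileCount a (D.low + k) j := by simp
    generalize Function.update (Function.update w 16 (32 + k)) 17
        (pileCount a (D.low + k) j) = w₁ at hw e16 e17 ⊢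
    have hf₁ : Frame a n s D w₁ := hf.congr (fun r hr => hw r (by omega))
      fun _ _ _ => hw _ (by omega)
    have e11 : w₁ 11 = j := by rw [hw _ (by omega), h11]
    have e12 : w₁ 12 = c := by rw [hw _ (by omega), h12]
    have e13 : w₁ 13 = k := by rw [hw _ (by omega), h13]
    have hc₁ : Counts a s D j w₁ := hc.congr (fun r hr => hw r (by omega)) (by omega)
    refine wp_jlt F rfl (by decide) hf₁.r0 e13 (fun hk0 => ?_) fun hk0 => ?_
    · refine (wp_push F hj hD hf₁ e11 e12 e13 e16 e17 hx (by omega) hp hc₁ hfk hkc hlt).mono ?_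
      rintro t' c' ⟨ht, h⟩
      exact ⟨by omega, h⟩
    · obtain rfl : k = 0 := by omega
      have hlow : 0 < D.low := by omega
      obtain ⟨hsrc, hiff⟩ := hf₁.src hlow j hj
      have hcnt := (pileCount_mono (a := a) D.low hj.le).trans (hD.count_low hlow)
      rw [Nat.add_zero] at e17
      refine wp_add F rfl (by decide) hf₁.r6 e17 (by omega) ?_
      refine wp_load F rfl (by decide) (Function.update_self ..)
        (Function.update_of_ne (by omega) _ _) (by omega) (by omega) ?_
      rw [Function.update_idem]
      generalize hz : w₁ (D.src + pileCount a D.low j) = z at hsrc hiff ⊢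
      have hf₂ : Frame a n s D (Function.update w₁ 18 z) :=
        hf₁.congr (fun r hr => Function.update_of_ne (by omega) _ _)
          fun _ _ _ => Function.update_of_ne (by omega) _ _
      have hc₂ : Counts a s D j (Function.update w₁ 18 z) :=
        hc₁.congr (fun r hr => Function.update_of_ne (by omega) _ _) (by omega)
      refine wp_jlt F rfl (by decide) (Function.update_self ..) (y := j) (by simp [e11])
        (fun hlt' => ?_) fun hge' => ?_
      · have hne : rank a j ≠ D.low := fun h => by have := hiff.2 h; omega
        refine (wp_next (c := c) F hj hD hf₂ (by simp [e11]) (by simp [e12])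
          (hp.skip fun i hi => by omega) (hc₂.skip fun i hi => by omega)).mono ?_
        rintro t' c' ⟨ht, h⟩
        exact ⟨by omega, h⟩
      refine wp_jlt F rfl (by decide) (x := j) (by simp [e11]) (Function.update_self ..)
        (fun hlt' => ?_) fun hge' => ?_
      · have hne : rank a j ≠ D.low := fun h => by have := hiff.2 h; omega
        refine (wp_next (c := c) F hj hD hf₂ (by simp [e11]) (by simp [e12])
          (hp.skip fun i hi => by omega) (hc₂.skip fun i hi => by omega)).mono ?_
        rintro t' c' ⟨ht, h⟩
        exact ⟨by omega, h⟩
      have heq := hiff.1 (by omega)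
      refine (wp_push (c := c) (k := 0) F hj hD hf₂ (by simp [e11]) (by simp [e12]) (by simp [e13])
        (by simp [e16]) (by simp [e17]) hx heq hp hc₂ hfk hkc hlt).mono ?_
      rintro t' c' ⟨ht, h⟩
      exact ⟨by omega, h⟩
  · refine wp_jump rfl ((wp_next F hj hD hf h11 h12 (hp.skip fun i hi => by omega)
      (hc.skip fun i hi => by omega)).mono ?_)
    rintro t' c' ⟨ht, h⟩
    exact ⟨by omega, h⟩

theorem wp_entry (F : Fits M a s) (hj : j < n) (hD : D.Valid a n s) (h : PassState a n s D j c w e)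
    {g : ℕ} (hg : 2 * s + 2 < 2 ^ g) :
    Wp M t ⟨19, w, e, j, p, o⟩ fun t' c' => t' ≤ t + 6 * g + 26 ∧ ∃ w' e' k,
      c' = ⟨19, w', e', j + 1, p, o⟩ ∧ PassState a n s D (j + 1) k w' e' := by
  have hf := h.frame
  have hbuf := hD.buffers
  have hsn := F.le
  have hcK := h.piles.le
  have hfc := h.piles.first_le
  refine wp_jlt F rfl (by decide) h.pos hf.r2 (fun _ => ?_) fun hnlt => absurd hj hnlt
  refine wp_take F rfl (by decide) hf.r4 (by omega) hj ?_
  refine wp_add F rfl (by decide) hf.r9 hf.r0 (by omega) ?_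
  refine wp_add F rfl (by decide) (x := c) (by simp [h.count]) (y := 0) (by simp [hf.r0])
    (by omega) ?_
  rw [Nat.add_zero, Nat.add_zero]
  have hp₁ : Piles a s D j c (Function.update e (2 * s + 2) (some ⟨j, hj⟩)) :=
    h.piles.congr fun i hi => Function.update_of_ne (by omega) _ _
  refine (wp_search F (Function.update_self ..) hcK (fun i h1 h2 => ?_)
    (hp₁.strictMono hD) g (by simp [hf.r0]) (by simp [hf.r1]) (by simp [hf.r4])
    (lo := D.first) (by simp) (hi := c) (by simp) le_rfl hfc le_rfl (by omega)
    (fun i q h1 h2 => by omega) (fun i q h1 h2 => by omega)).bind ?_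
  · obtain ⟨q, hq, -⟩ := hp₁.top i h1 h2
    exact ⟨q, hq⟩
  · rintro t' c' ⟨ht, w', k, rfl, hw, h13, hfk, hkc, hlo, hhi⟩
    have hw' : ∀ r, r < 13 ∨ 15 < r → w' r = w r := fun r hr => by
      rw [hw r hr, Function.update_of_ne (by omega), Function.update_of_ne (by omega)]
    refine (wp_place (c := c) F hj hD ⟨hf.congr (fun r hr => hw' r (by omega))
      fun _ _ _ => hw' _ (by omega), by rw [hw' _ (by omega), h.pos],
      by rw [hw' _ (by omega), h.count], hp₁, h.counts.congr (fun r hr => hw' r (by omega))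
      (by omega)⟩ h13 (Function.update_self ..) hfk hkc hlo hhi).mono ?_
    rintro t'' c' ⟨ht', h⟩
    exact ⟨by omega, h⟩

theorem wp_scan (F : Fits M a s) (hD : D.Valid a n s) {g : ℕ} (hg : 2 * s + 2 < 2 ^ g) (m : ℕ)
    (hm : j + m = n) (h : PassState a n s D j c w e) :
    Wp M t ⟨19, w, e, j, p, o⟩ fun t' c' => t' ≤ t + m * (6 * g + 26) + 2 ∧ ∃ w' e' k,
      c' = ⟨54, w', e', n, p, o⟩ ∧ PassState a n s D n k w' e' := by
  induction m generalizing t j c w e with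
  | zero =>
    obtain rfl : j = n := by omega
    refine wp_jlt F rfl (by decide) h.pos h.frame.r2 (fun hlt => absurd hlt (lt_irrefl _))
      fun _ => ?_
    exact wp_jump rfl (.done ⟨by omega, w, e, c, rfl, h⟩)
  | succ m ih =>
    refine (wp_entry F (by omega) hD h hg).bind ?_
    rintro t' c' ⟨ht, w', e', k, rfl, h'⟩
    refine (ih (by omega) h').mono ?_
    rintro t'' c' ⟨ht', h⟩
    refine ⟨?_, h⟩
    rw [Nat.succ_mul]
    omega

/-- The loop tests after clearing, so m counts the cells beyond the current one, and m + 1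
iterations of four instructions remain. -/
theorem wp_clear (F : Fits M a s) (hD : D.Valid a n s) {h : ℕ} (m i : ℕ) (hm : i + m = 2 * s + 1)
    (hf : Frame a n s D w) (h15 : w 15 = i) (h11 : w 11 = 0) (h12 : w 12 = c)
    (hz : ∀ i' < i, w (32 + i') = 0) :
    Wp M t ⟨15, w, e, h, p, o⟩ fun t' c' => t' ≤ t + 4 * (m + 1) ∧ ∃ w',
      c' = ⟨19, w', e, h, p, o⟩ ∧ Frame a n s D w' ∧ w' 11 = 0 ∧ w' 12 = c ∧
      ∀ i < 2 * s + 2, w' (32 + i) = 0 := by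
  have hbuf := hD.buffers
  have hsn := F.le
  induction m using Nat.strong_induction_on generalizing t i w with
  | _ m ih =>
    refine wp_add F rfl (by decide) hf.r5 h15 (by omega) ?_
    refine wp_store F rfl (by decide) (Function.update_self ..) (y := 0) (by simp [hf.r0])
      (by omega) (by omega) ?_
    refine wp_add F rfl (by decide) (x := i)
      (by rw [Function.update_of_ne (by omega), Function.update_of_ne (by omega), h15]) (y := 1)
      (by rw [Function.update_of_ne (by omega), Function.update_of_ne (by omega), hf.r1])
      (by omega) ?_
    have hw : ∀ r, r ≠ 15 → r ≠ 16 → r ≠ 32 + i → Function.update (Function.update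
        (Function.update w 16 (32 + i)) (32 + i) 0) 15 (i + 1) r = w r := fun r h1 h2 h3 => by
      rw [Function.update_of_ne h1, Function.update_of_ne h3, Function.update_of_ne h2]
    have hwi : Function.update (Function.update
        (Function.update w 16 (32 + i)) (32 + i) 0) 15 (i + 1) (32 + i) = 0 := by
      rw [Function.update_of_ne (by omega), Function.update_self]
    have e15 : Function.update (Function.update
        (Function.update w 16 (32 + i)) (32 + i) 0) 15 (i + 1) 15 = i + 1 :=
      Function.update_self ..
    generalize Function.update (Function.update
        (Function.update w 16 (32 + i)) (32 + i) 0) 15 (i + 1) = w₁ at hw hwi e15 ⊢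
    have hf₁ : Frame a n s D w₁ :=
      hf.congr (fun r hr => hw r (by omega) (by omega) (by omega))
        fun _ _ _ => hw _ (by omega) (by omega) (by omega)
    have e11 : w₁ 11 = 0 := by rw [hw _ (by omega) (by omega) (by omega), h11]
    have e12 : w₁ 12 = c := by rw [hw _ (by omega) (by omega) (by omega), h12]
    have hz₁ : ∀ i' < i + 1, w₁ (32 + i') = 0 := fun i' hi' => by
      by_cases hii : i' = i
      · rw [hii, hwi]
      · rw [hw _ (by omega) (by omega) (by omega), hz i' (by omega)]
    refine wp_jlt F rfl (by decide) e15 hf₁.r4 (fun hlt => ?_) fun hge => ?_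
    · refine (ih (m - 1) (by omega) (i + 1) (by omega) hf₁ e15 e11 e12 hz₁).mono ?_
      rintro t' c' ⟨ht, h⟩
      exact ⟨by omega, h⟩
    · exact .done ⟨by omega, w₁, rfl, hf₁, e11, e12, fun i' hi' => hz₁ i' (by omega)⟩

theorem wp_pass (F : Fits M a s) (hD : D.Valid a n s) {g : ℕ} (hg : 2 * s + 2 < 2 ^ g) {h : ℕ}
    (hf : Frame a n s D w) :
    Wp M t ⟨11, w, e, h, p, o⟩ fun t' c' => t' ≤ t + n * (6 * g + 26) + 8 * s + 14 ∧
      ∃ w' e' k, c' = ⟨54, w', e', n, p + 1, o⟩ ∧ PassState a n s D n k w' e' := by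
  have hfirst := hD.first
  have hbuf := hD.buffers
  refine wp_rewind rfl ?_
  refine wp_const F rfl (by decide) ?_
  refine wp_add F rfl (by decide) (x := D.first) (by simp [hf.r9]) (y := 0) (by simp [hf.r0])
    (by omega) ?_
  refine wp_const F rfl (by decide) ?_
  refine (wp_clear (c := D.first) F hD (2 * s + 1) 0 (by omega) ?_ (by simp) (by simp) (by simp)
    (fun i hi => by omega)).bind ?_
  · refine hf.congr (fun r hr => ?_) fun _ _ _ => ?_
    · rw [Function.update_of_ne (by omega), Function.update_of_ne (by omega),
        Function.update_of_ne (by omega)]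
    · rw [Function.update_of_ne (by omega), Function.update_of_ne (by omega),
        Function.update_of_ne (by omega)]
  · rintro t' c' ⟨ht, w', rfl, hf', h11, h12, hz⟩
    refine (wp_scan F hD hg n (by omega) ⟨hf', h11, h12, .init (by omega), ?_, ?_⟩).mono ?_
    · intro i hi
      rw [hz i hi, pileCount_zero]
    · intro _ q hq
      exact absurd hq (Nat.not_lt_zero _)
    · rintro t'' c' ⟨ht', h⟩
      exact ⟨by omega, h⟩

end pass

/-! ### Rounds and the whole computation -/

section rounds
variable {n : ℕ} {M : Env n} {s : ℕ} {a : ℕ → ℤ} {D : PassData} {t h p : ℕ} {w : ℕ → ℕ}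
  {e : ℕ → Option (Fin n)} {o : List ℕ}

theorem Frame.set_target (hf : Frame a n s D w) (hb : 32 ≤ D.src) (k : ℕ) :
    Frame a n s { D with target := k } (Function.update w 10 k) where
  r0 := by simp [hf.r0]
  r1 := by simp [hf.r1]
  r2 := by simp [hf.r2]
  r3 := by simp [hf.r3]
  r4 := by simp [hf.r4]
  r5 := by simp [hf.r5]
  r6 := by simp [hf.r6]
  r7 := by simp [hf.r7]
  r8 := by simp [hf.r8]
  r9 := by simp [hf.r9]
  r10 := by simp
  src hl j hj := by
    rw [Function.update_of_ne (by simp only; omega)]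
    exact hf.src hl j hj

/-- The given small pile k guarantees that the upward search stops inside the window; it may stop
earlier, at another small pile. -/
theorem wp_find (F : Fits M a s) (hb : 32 ≤ D.src) {k : ℕ} (hk : k < 2 * s)
    (hcount : pileCount a (D.low + k) n ≤ s) (d : ℕ) (hd : D.target + d = k)
    (hf : Frame a n s D w)
    (hsize : ∀ i < 2 * s + 2, w (32 + i) = pileCount a (D.low + i) n) :
    Wp M t ⟨57, w, e, h, p, o⟩ fun t' c' => t' ≤ t + 5 * d + 4 ∧ ∃ w' i,
      c' = ⟨11, w', e, h, p, o⟩ ∧ D.target ≤ i ∧ i < 2 * s ∧ pileCount a (D.low + i) n ≤ s ∧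
      Frame a n s { D with target := i } w' := by
  have hsn := F.le
  induction d generalizing t w D with
  | zero =>
    rw [Nat.add_zero] at hd
    subst hd
    have hle := pileCount_le (a := a) (D.low + D.target) n
    refine wp_add F rfl (by decide) hf.r5 hf.r10 (by omega) ?_
    refine wp_load F rfl (by decide) (Function.update_self ..)
      (by rw [Function.update_of_ne (by omega), hsize _ (by omega)]) (by omega) (by omega) ?_
    refine wp_jlt F rfl (by decide) (x := s) (by simp [hf.r3]) (Function.update_self ..)
      (fun hlt => by omega) fun _ => ?_
    refine wp_jump rfl (.done ⟨by omega, _, D.target, rfl, le_rfl, hk, hcount, ?_⟩)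
    refine hf.congr (fun r hr => ?_) fun _ _ _ => ?_
    · rw [Function.update_of_ne (by omega), Function.update_of_ne (by omega)]
    · rw [Function.update_of_ne (by omega), Function.update_of_ne (by omega)]
  | succ d ih =>
    have hle := pileCount_le (a := a) (D.low + D.target) n
    refine wp_add F rfl (by decide) hf.r5 hf.r10 (by omega) ?_
    refine wp_load F rfl (by decide) (Function.update_self ..)
      (by rw [Function.update_of_ne (by omega), hsize _ (by omega)]) (by omega) (by omega) ?_
    have hw : ∀ r, r < 16 ∨ 17 < r → Function.update (Function.update w 16 (32 + D.target)) 17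
        (pileCount a (D.low + D.target) n) r = w r := fun r hr => by
      rw [Function.update_of_ne (by omega), Function.update_of_ne (by omega)]
    have e17 : Function.update (Function.update w 16 (32 + D.target)) 17
        (pileCount a (D.low + D.target) n) 17 = pileCount a (D.low + D.target) n := by simp
    generalize Function.update (Function.update w 16 (32 + D.target)) 17
        (pileCount a (D.low + D.target) n) = w₁ at hw e17 ⊢
    have hf₁ : Frame a n s D w₁ := hf.congr (fun r hr => hw r (by omega))
      fun _ _ _ => hw _ (by omega)
    refine wp_jlt F rfl (by decide) hf₁.r3 e17 (fun hlt => ?_) fun hge => ?_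
    · refine wp_add F rfl (by decide) hf₁.r10 hf₁.r1 (by omega) ?_
      refine wp_jump rfl ((ih (D := { D with target := D.target + 1 }) hb hcount
        (by simp only; omega) (hf₁.set_target hb _) fun i hi => ?_).mono ?_)
      · rw [Function.update_of_ne (by omega), hw _ (by omega), hsize i hi]
      · rintro t' c' ⟨ht, w', i, rfl, hi, h⟩
        exact ⟨by omega, w', i, rfl, by simp only at hi; omega, h⟩
    · exact wp_jump rfl (.done ⟨by omega, _, D.target, rfl, le_rfl, by omega, by omega, hf₁⟩)

theorem PassData.Valid.low_le (hD : D.Valid a n s) : D.low ≤ n := by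
  rcases Nat.eq_zero_or_pos D.low with h | h
  · omega
  · obtain ⟨p, hp, hr⟩ := hD.exists_low h
    have := rank_le (a := a) p
    omega

/-- If the window has an empty pile, the length of a longest increasing subsequence is known. -/
theorem Piles.lis_eq (F : Fits M a s) (hD : D.Valid a n s) {c : ℕ} (hp : Piles a s D n c e)
    (hc : c < 2 * s + 2) : lis M.entry = D.low + c - 1 := by
  have hfirst := hD.first
  have hfc := hp.first_le
  -- If `first` is 0, the lowest pile is known to be nonempty.
  have hc0 : 0 < c := by
    by_contra hc0
    obtain ⟨p, hpn, hr⟩ := hD.exists_low (by omega)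
    exact hc0 (hp.lt_of_rank p hpn 0 (by omega) hr)
  refine SpaceLIS.lis_eq F.entry (fun p hpn => ?_) ?_
  · by_contra hlt
    rcases (show D.low + c ≤ rank a p by omega).eq_or_lt with he | hlt
    · exact lt_irrefl _ (hp.lt_of_rank p hpn c hc he.symm)
    · obtain ⟨i, hi, -, hr⟩ := exists_rank_eq (a := a) (j := p) (by omega) hlt
      exact lt_irrefl _ (hp.lt_of_rank i (hi.trans hpn) c hc hr)
  · by_cases h : D.first ≤ c - 1
    · obtain ⟨q, -, hq, hr, -⟩ := hp.top (c - 1) h (by omega)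
      exact .inr ⟨q, hq, by omega⟩
    -- Only `low = 0` and c = `first` = 1 remain, that is, no pile at all.
    · left
      omega

theorem wp_round (F : Fits M a s) (hD : PassData.Valid { D with target := 2 * s + 2 } a n s)
    {g : ℕ} (hg : 2 * s + 2 < 2 ^ g) (hf : Frame a n s D w) :
    Wp M t ⟨10, w, e, h, p, []⟩ fun t' c' => t' ≤ t + 2 * (n * (6 * g + 26)) + 21 * s + 60 ∧
      ((∃ w' e', c' = ⟨76, w', e', n, p + 1, [lis M.entry]⟩) ∨
        ∃ D' w' e', c' = ⟨10, w', e', n, p + 2, []⟩ ∧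
          PassData.Valid { D' with target := 2 * s + 2 } a n s ∧ Frame a n s D' w' ∧
          D.low + s ≤ D'.low ∧ 0 < s) := by
  have hsn := F.le
  have hbuf := hD.buffers
  have hfirst := hD.first
  have hlow := hD.low_le
  simp only at hbuf hfirst hlow
  refine wp_add F rfl (by decide) hf.r4 hf.r0 (by omega) ?_
  refine (wp_pass F hD hg (hf.set_target (by omega) _)).bind ?_
  rintro t₁ c₁ ⟨ht₁, w₁, e₁, c, rfl, hf₁, -, h12, hp, hc⟩
  have hcK := hp.le
  refine wp_jlt F rfl (by decide) hf₁.r10 hf₁.r4 (fun hlt => absurd hlt (lt_irrefl _)) fun _ => ?_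
  refine wp_jlt F rfl (by decide) h12 hf₁.r4 (fun hlt => ?_) fun hge => ?_
  · refine wp_add F rfl (by decide) hf₁.r8 (y := c) h12 (by simp only; omega) ?_
    refine wp_sub F rfl (by decide) (Function.update_self ..) (y := 1) (by simp [hf₁.r1])
      (by simp only; omega) ?_
    refine wp_out F rfl (by decide) (Function.update_self ..) ?_
    rw [hp.lis_eq F hD hlt]
    exact .done ⟨by omega, .inl ⟨_, _, rfl⟩⟩
  · obtain rfl : c = 2 * s + 2 := by omega
    -- A full window excludes n = s = 0; that input is answered in the branch above.
    have hn : 0 < n := by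
      obtain ⟨q, -⟩ := hp.top (2 * s + 1) (by simp only; omega) (by omega)
      exact q.pos
    have hs : 0 < s := by
      have := F.sq
      by_contra hs
      obtain rfl : s = 0 := by omega
      omega
    obtain ⟨k, hsk, hk, hcount⟩ := exists_pileCount_le (a := a) hs F.sq D.low
    refine wp_add F rfl (by decide) hf₁.r3 hf₁.r0 (by omega) ?_
    refine (wp_find (D := { D with target := s }) F (by simp only; omega) hk hcount (k - s)
      (by simp only; omega) (hf₁.set_target (by simp only; omega) s) fun i hi => ?_).bind ?_
    · rw [Function.update_of_ne (by omega), hc.size i hi]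
    rintro t₂ c₂ ⟨ht₂, w₂, i, rfl, hsi, hi, hcnt, hf₂⟩
    simp only at hsi hcnt hf₂
    have hex : ∃ p < n, rank a p = D.low + i := by
      obtain ⟨q, -, hq, hr, -⟩ := hp.top i (by simp only; omega) (by omega)
      exact ⟨q, hq, hr⟩
    have hlow' : D.low + i ≤ n := by
      obtain ⟨q, hq, hr⟩ := hex
      have := rank_le (a := a) q
      omega
    have hD₂ : PassData.Valid { D with target := i } a n s :=
      ⟨hD.first, hD.buffers, hD.exists_low, hD.count_low,
        .inr ⟨hsi, by simp only; omega, hcnt, hex⟩⟩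
    refine (wp_pass F hD₂ hg hf₂).bind ?_
    rintro t₃ c₃ ⟨ht₃, w₃, e₃, c', rfl, hf₃, -, -, hp₃, hc₃⟩
    have hsz := hc₃.size i (by omega)
    have hdst := hc₃.dst (by simp only; omega)
    simp only at hsz hdst
    refine wp_jlt F rfl (by decide) hf₃.r10 hf₃.r4 (fun _ => ?_) fun hge => by
      simp only at hge
      omega
    refine wp_add F rfl (by decide) hf₃.r5 hf₃.r10 (by simp only; omega) ?_
    refine wp_load F rfl (by decide) (Function.update_self ..) (y := pileCount a (D.low + i) n)
      (by rw [Function.update_of_ne (by simp only; omega), hsz]) (by simp only; omega)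
      (by omega) ?_
    refine wp_add F rfl (by decide) (x := D.dst) (by simp [hf₃.r7]) (Function.update_self ..)
      (by omega) ?_
    -- The recorded list is closed by the sentinel n.
    refine wp_store F rfl (by decide) (Function.update_self ..) (y := n) (by simp [hf₃.r2])
      (by omega) (by omega) ?_
    have hw : ∀ r, r < 16 ∨ 18 < r → r ≠ D.dst + pileCount a (D.low + i) n →
        Function.update (Function.update (Function.update (Function.update w₃ 16 (32 + i)) 17
          (pileCount a (D.low + i) n)) 18 (D.dst + pileCount a (D.low + i) n))
          (D.dst + pileCount a (D.low + i) n) n r = w₃ r := fun r h1 h2 => by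
      rw [Function.update_of_ne h2, Function.update_of_ne (by omega),
        Function.update_of_ne (by omega), Function.update_of_ne (by omega)]
    have hwn : Function.update (Function.update (Function.update (Function.update w₃ 16 (32 + i)) 17
          (pileCount a (D.low + i) n)) 18 (D.dst + pileCount a (D.low + i) n))
          (D.dst + pileCount a (D.low + i) n) n (D.dst + pileCount a (D.low + i) n) = n :=
      Function.update_self ..
    simp only
    generalize Function.update (Function.update (Function.update (Function.update w₃ 16 (32 + i)) 17
          (pileCount a (D.low + i) n)) 18 (D.dst + pileCount a (D.low + i) n))
          (D.dst + pileCount a (D.low + i) n) n = w₄ at hw hwn ⊢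
    have hreg : ∀ r ≤ 10, w₄ r = w₃ r := fun r hr => hw r (by omega) (by omega)
    have hlist : ∀ q < n, rank a q = D.low + i → w₄ (D.dst + pileCount a (D.low + i) q) = q :=
      fun q hq hr => by
        have := pileCount_lt hq hr
        rw [hw _ (by omega) (by omega), hdst q hq hr]
    refine wp_add F rfl (by decide) (x := D.low) (by rw [hreg _ (by decide), hf₃.r8]) (y := i)
      (by rw [hreg _ (by decide), hf₃.r10]) (by omega) ?_
    refine wp_add F rfl (by decide) (x := D.src) (by simp [hreg, hf₃.r6]) (y := 0)
      (by simp [hreg, hf₃.r0]) (by omega) ?_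
    refine wp_add F rfl (by decide) (x := D.dst) (by simp [hreg, hf₃.r7]) (y := 0)
      (by simp [hreg, hf₃.r0]) (by omega) ?_
    refine wp_add F rfl (by decide) (x := D.src) (by simp) (y := 0)
      (by simp [hreg, hf₃.r0]) (by omega) ?_
    refine wp_const F rfl (by decide) ?_
    -- The two buffers swap roles. The target stays i because register 10 is reset only at the start
    -- of the next round.
    refine wp_jump rfl (.done ⟨by omega, .inr ⟨⟨D.low + i, 0, i, D.dst, D.src⟩, _, _, rfl,
      ⟨.inr ⟨by simp only; omega, rfl⟩, hbuf.symm.imp And.symm And.symm, fun _ => hex,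
        fun _ => hcnt, .inl rfl⟩, ?_, by simp only; omega, hs⟩⟩)
    constructor
    case src =>
      intro _ j hj
      have := list_eq_iff (f := fun x => w₄ (D.dst + x)) hlist hwn hj
      simp only
      rwa [Function.update_of_ne (by omega), Function.update_of_ne (by omega),
        Function.update_of_ne (by omega), Function.update_of_ne (by omega),
        Function.update_of_ne (by omega)]
    all_goals simp [hreg, hf₃.r0, hf₃.r1, hf₃.r2, hf₃.r3, hf₃.r4, hf₃.r5, hf₃.r10]

/-- The potential `n - low` drops by at least s per round, so rounds times s is at most m + s, the
last s paying for the final round. Multiplying by s avoids division and covers s = 0. -/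
theorem wp_rounds (F : Fits M a s) {g T : ℕ} (hg : 2 * s + 2 < 2 ^ g)
    (hT : T = 2 * (n * (6 * g + 26)) + 21 * s + 60) (m : ℕ)
    (hD : PassData.Valid { D with target := 2 * s + 2 } a n s) (hm : n - D.low = m)
    (hf : Frame a n s D w) :
    Wp M t ⟨10, w, e, h, p, []⟩ fun t' c' => s * t' ≤ s * t + (m + s) * T ∧
      c'.pc = 76 ∧ c'.output = [lis M.entry] ∧ s * c'.passes ≤ s * p + (m + s) * 2 := by
  induction m using Nat.strong_induction_on generalizing D t h p w e with
  | _ m ih =>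
    refine (wp_round F hD hg hf).bind ?_
    rintro t₁ c₁ ⟨ht, ⟨w', e', rfl⟩ | ⟨D', w', e', rfl, hD', hf', hlow, hs⟩⟩
    · refine .done ⟨?_, rfl, rfl, ?_⟩
      · have := Nat.mul_le_mul_left s (show t₁ ≤ t + T by omega)
        nlinarith
      · simp only
        nlinarith
    · have h1 := hD'.low_le
      simp only at h1
      refine (ih (n - D'.low) (by omega) hD' rfl hf').mono ?_
      rintro t₂ c₂ ⟨ht₂, hpc, ho, hpass⟩
      have h2 : n - D'.low + s ≤ m := by omega
      refine ⟨?_, hpc, ho, ?_⟩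
      · have h3 := Nat.mul_le_mul_left s (show t₁ ≤ t + T by omega)
        have h4 := Nat.mul_le_mul_right T h2
        nlinarith
      · nlinarith

theorem computes_lis (F : Fits M a s) {g T : ℕ} (hg : 2 * s + 2 < 2 ^ g)
    (hT : T = 2 * (n * (6 * g + 26)) + 21 * s + 60) :
    ∃ t p, Computes lisProgram M (lis M.entry) t p ∧ s * t ≤ s * 10 + (n + s) * T ∧
      s * p ≤ s + (n + s) * 2 := by
  have hsn := F.le
  have key : Wp M 0 (Config.init n) fun t' c' => s * t' ≤ s * 10 + (n + s) * T ∧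
      c'.pc = 76 ∧ c'.output = [lis M.entry] ∧ s * c'.passes ≤ s * 1 + (n + s) * 2 := by
    refine wp_const F rfl (by decide) ?_
    refine wp_len F rfl (by decide) ?_
    refine wp_par F rfl (by decide) ?_
    refine wp_add F rfl (by decide) (x := s) (by simp) (y := s) (by simp) (by omega) ?_
    refine wp_add F rfl (by decide) (x := s + s) (by simp) (y := 1) (by simp) (by omega) ?_
    refine wp_add F rfl (by decide) (x := s + s + 1) (by simp) (y := 1) (by simp) (by omega) ?_
    refine wp_const F rfl (by decide) ?_
    refine wp_add F rfl (by decide) (x := 32) (by simp) (y := s + s + 1 + 1) (by simp)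
      (by omega) ?_
    refine wp_add F rfl (by decide) (x := 32 + (s + s + 1 + 1)) (by simp) (y := s + s + 1 + 1)
      (by simp) (by omega) ?_
    refine wp_const F rfl (by decide) ?_
    -- The target is 0 since register 10 has not been written yet.
    refine wp_rounds (D := ⟨0, 1, 0, 2 * s + 34, 4 * s + 36⟩) F hg hT n
      ⟨.inl ⟨rfl, rfl⟩, .inl ⟨rfl, rfl⟩, fun h => absurd h (lt_irrefl _),
        fun h => absurd h (lt_irrefl _), .inl rfl⟩ rfl ?_
    constructor
    case src => exact fun h => absurd h (lt_irrefl _)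
    all_goals simp
    all_goals omega
  obtain ⟨k, c, hk, ht, hpc, ho, hp⟩ := key
  exact ⟨k, c.passes, ⟨c, hk, by rw [hpc]; rfl, ho, rfl⟩, by simpa using ht, by simpa using hp⟩

end rounds

/-! ### Numerical estimates and conclusion -/

theorem le_two_pow_log {n : ℕ} : n + 1 ≤ 2 ^ (Nat.log 2 n + 1) :=
  Nat.lt_pow_succ_log_self (by decide) n

theorem fits {n s : ℕ} {M : Env n} (hle : s ≤ n) (hsq : n ≤ s * s) (hp : M.param = s)
    (hc : M.cells = 6 * s + 38) (hw : M.wordBits = 10 * (Nat.log 2 n + 1)) :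
    Fits M (fun p => if h : p < n then M.entry ⟨p, h⟩ else 0) s where
  entry p := by simp
  param := hp
  le := hle
  sq := hsq
  cells := hc
  word v hv := by
    rw [hw, mul_comm, pow_mul]
    have h1 := le_two_pow_log (n := n)
    have h2 : 2 ≤ 2 ^ (Nat.log 2 n + 1) := Nat.le_self_pow (by omega) 2
    -- Nine of the ten factors give 512, and 512(n + 1) exceeds 10n + 100.
    have h3 : 2 ^ 9 ≤ (2 ^ (Nat.log 2 n + 1)) ^ 9 := Nat.pow_le_pow_left h2 9
    rw [pow_succ]
    generalize 2 ^ (Nat.log 2 n + 1) = N at *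
    have h4 := Nat.mul_le_mul_right N h3
    omega

/-- Since log 2 > 1/2, both the binary logarithm and 1 are at most 2 log n. -/
theorem log_two_add_one_le {n : ℕ} (hn : 2 ≤ n) : (Nat.log 2 n + 1 : ℝ) ≤ 4 * Real.log n := by
  have h2 : (1 / 2 : ℝ) < Real.log 2 := by linarith [Real.log_two_gt_d9]
  have hn' : (2 : ℝ) ≤ n := by exact_mod_cast hn
  have h3 : Real.log 2 ≤ Real.log n := Real.log_le_log (by norm_num) hn'
  have h4 : (Nat.log 2 n : ℝ) * Real.log 2 ≤ Real.log n := by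
    rw [← Real.log_pow]
    refine Real.log_le_log (by positivity) ?_
    exact_mod_cast Nat.pow_log_le_self 2 (by omega)
  have h5 : (0 : ℝ) ≤ Nat.log 2 n := Nat.cast_nonneg _
  nlinarith

end SpaceLIS

theorem mainTheorem1 :
    ∃ (P : SpaceLIS.Program) (k : ℕ) (C : ℝ), ∀ n s : ℕ, Real.sqrt n ≤ s → s ≤ n →
      ∃ m : ℕ, ∀ σ : Fin n → ℤ,
        let M : SpaceLIS.Env n :=
          { entry := σ, param := s, wordBits := k * (Nat.log 2 n + 1), cells := m }
        ∃ t p : ℕ, SpaceLIS.Computes P M (SpaceLIS.lis σ) t p ∧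
          (2 ≤ n →
            (t : ℝ) ≤ C * ((n : ℝ) ^ 2 * Real.log n / s) ∧
            (M.memoryBits : ℝ) ≤ C * (s * Real.log n) ∧
            (p : ℝ) ≤ C * ((n : ℝ) / s)) := by
  -- The constant 2000 covers 4 · 348 for time, 4 · 485 for memory and 5 for passes; the factor 4
  -- comes from `log_two_add_one_le`.
  refine ⟨SpaceLIS.lisProgram, 10, 2000, fun n s hs hsn => ⟨6 * s + 38, fun σ => ?_⟩⟩
  intro M
  have hsq : n ≤ s * s := by
    have := (Real.sqrt_le_left (Nat.cast_nonneg s)).1 hs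
    rw [sq] at this
    exact_mod_cast this
  obtain ⟨t, p, hcomp, ht, hp⟩ := SpaceLIS.computes_lis
    (SpaceLIS.fits (M := M) hsn hsq rfl rfl rfl) (g := Nat.log 2 n + 3)
    (by have := SpaceLIS.le_two_pow_log (n := n); rw [pow_add]; rw [pow_add] at this; omega) rfl
  refine ⟨t, p, hcomp, fun hn => ?_⟩
  have hlog := SpaceLIS.log_two_add_one_le hn
  have hs0 : 0 < s := by
    by_contra hs0
    obtain rfl : s = 0 := by omega
    omega
  have hs1 : (1 : ℝ) ≤ s := by exact_mod_cast hs0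
  have hn2 : (2 : ℝ) ≤ n := by exact_mod_cast hn
  have htime : s * t ≤ 348 * (n ^ 2 * (Nat.log 2 n + 1)) := by
    have hT : 2 * (n * (6 * (Nat.log 2 n + 3) + 26)) + 21 * s + 60 ≤
        169 * (n * (Nat.log 2 n + 1)) := by nlinarith
    have h1 := Nat.mul_le_mul (show n + s ≤ 2 * n by omega) hT
    have h2 : n * 1 ≤ n * (n * (Nat.log 2 n + 1)) :=
      Nat.mul_le_mul_left n (Nat.mul_pos (by omega) (Nat.succ_pos _))
    calc s * t ≤ 10 * (n * 1) +
            (n + s) * (2 * (n * (6 * (Nat.log 2 n + 3) + 26)) + 21 * s + 60) := by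
          omega
      _ ≤ 10 * (n * (n * (Nat.log 2 n + 1))) + 2 * n * (169 * (n * (Nat.log 2 n + 1))) := by
          omega
      _ = 348 * (n ^ 2 * (Nat.log 2 n + 1)) := by ring
  have hmem : M.memoryBits ≤ 485 * (s * (Nat.log 2 n + 1)) := by
    have h1 : (6 * s + 38) * (Nat.log 2 n + 1) ≤ 44 * s * (Nat.log 2 n + 1) :=
      Nat.mul_le_mul_right _ (by omega)
    have h2 : 1 * (Nat.log 2 n + 1) ≤ s * (Nat.log 2 n + 1) := Nat.mul_le_mul_right _ hs0
    calc M.memoryBits = 11 * ((6 * s + 38) * (Nat.log 2 n + 1)) + 1 * (Nat.log 2 n + 1) := by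
          simp only [SpaceLIS.Env.memoryBits, M]
          ring
      _ ≤ 11 * (44 * s * (Nat.log 2 n + 1)) + s * (Nat.log 2 n + 1) := by omega
      _ = 485 * (s * (Nat.log 2 n + 1)) := by ring
  have hpass : s * p ≤ 5 * n := by omega
  have hlog0 : 0 ≤ Real.log n := Real.log_nonneg (by linarith)
  refine ⟨?_, ?_, ?_⟩
  · rw [← mul_div_assoc, le_div_iff₀ (by linarith), mul_comm]
    have h1 : (s * t : ℝ) ≤ 348 * (n ^ 2 * (Nat.log 2 n + 1)) := by exact_mod_cast htime
    have h2 := mul_le_mul_of_nonneg_left hlog (sq_nonneg (n : ℝ))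
    have h3 : 0 ≤ (n : ℝ) ^ 2 * Real.log n := by positivity
    linarith
  · have h1 : (M.memoryBits : ℝ) ≤ 485 * (s * (Nat.log 2 n + 1)) := by exact_mod_cast hmem
    have h2 := mul_le_mul_of_nonneg_left hlog (Nat.cast_nonneg s : (0 : ℝ) ≤ s)
    have h3 : 0 ≤ (s : ℝ) * Real.log n := by positivity
    linarith
  · rw [← mul_div_assoc, le_div_iff₀ (by linarith), mul_comm]
    have h1 : (s * p : ℝ) ≤ 5 * n := by exact_mod_cast hpass
    linarith
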